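/- A simple game on a finite player set $N$ is a family $\mathcal W$ of subsets of $N$ (the winning coalitions; the other subsets are losing) with $\emptyset\notin\mathcal W$, $N\in\mathcal W$, and closed under taking supersets. It is weighted if there are weights $w_i\ge 0$ and a quota $q>0$ such that $S\in\mathcal W$ if and only if $\sum_{i\in S}w_i\ge q$. Write $i\succsim j$ if for every $S\in\mathcal W$ with $j\in S$, exchanging the roles of $i$ and $j$ in $S$ gives a winning coalition; call $i,j$ equivalent if $i\succsim j$ and $j\succsim i$. In a weighted game $\succsim$ is total, so the equivalence classes are linearly ordered, $N_1>N_2>\dots>N_t$ from most to least desirable. A vector $m=(m_1,\dots,m_t)$ of integers with $0\le m_h\le |N_h|$ is winning (losing) if the coalitions with exactly $m_h$ players from each $N_h$ are winning (losing). It is shift-minimal winning if it is winning and every vector $m'\ne m$ with $\sum_{h\le k}m'_h\le\sum_{h\le k}m_h$ for all $1\le k\le t$ is losing. A game is non-trivial if it has no veto player (a player in every winning coalition) and no null player (a player in no inclusion-minimal winning coalition). Let $wg(n,t,r)$ be the number, up to isomorphism (bijections of the players that preserve and reflect winning coalitions), of weighted games with $n$ players, $t$ equivalence classes and $r$ shift-minimal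 winning vectors, and let $\widehat{wg}(n,t,r)$ be the number of non-trivial ones among them. **Theorem.** For every $n\ge 1$: $$\widehat{wg}(n,1,1)=n-1,\qquad \widehat{wg}(n,2,1)=\begin{cases}0,& n\le 2,\\ n^2-6n+9,& n\ge 3,\end{cases}\qquad \widehat{wg}(n,t,1)=0\ \text{ for } t\ge 3,$$ $$wg(n,1,1)=n,\qquad wg(n,2,1)=\begin{cases}n-1,& n\le 2,\\ 2(n-2)^2+2,& n\ge 3,\end{cases}$$ $$wg(n,3,1)=\begin{cases}0,& n\le 3,\\ \dfrac{5n^3-48n^2+157n-174}{6},& n\ge 4,\end{cases}$$ $$wg(n,4,1)=\begin{cases}0,& n\le 5,\\ \dfrac{n^4-16n^3+95n^2-248n+240}{12},& n\ge 6,\end{cases}$$ $$wg(n,t,1)=0\ \text{ for } t\ge 5.$$ -/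

import Mathlib

/-- A (monotonic) simple game on a finite set `N` of players: the family of winning coalitions
does not contain `∅`, contains the grand coalition, and is closed under taking supersets. -/
@[ext]
structure SimpleGame (N : Type*) [Fintype N] where
  winning : Set (Finset N)
  empty_notMem : ∅ ∉ winning
  univ_mem : Finset.univ ∈ winning
  mono : ∀ S T : Finset N, S ∈ winning → S ⊆ T → T ∈ winning

namespace SimpleGame

/-- `[q; w₁, …, wₙ]` represents the game, for some nonnegative weights and positive quota. -/
def IsWeighted {N : Type*} [Fintype N] (G : SimpleGame N) : Prop :=
  ∃ (w : N → ℝ) (q : ℝ), (∀ i, 0 ≤ w i) ∧ 0 < q ∧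
    ∀ S : Finset N, S ∈ G.winning ↔ q ≤ ∑ i ∈ S, w i

/-- Minimal winning coalitions: every proper subcoalition is losing. -/
def IsMinimalWinning {N : Type*} [Fintype N] (G : SimpleGame N) (S : Finset N) : Prop :=
  S ∈ G.winning ∧ ∀ T, T ⊂ S → T ∉ G.winning

/-- Veto players belong to every winning coalition. -/
def IsVeto {N : Type*} [Fintype N] (G : SimpleGame N) (i : N) : Prop :=
  ∀ S ∈ G.winning, i ∈ S

/-- Null players belong to no minimal winning coalition. -/
def IsNull {N : Type*} [Fintype N] (G : SimpleGame N) (i : N) : Prop :=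
  ∀ S, G.IsMinimalWinning S → i ∉ S

/-- A game is non-trivial if it has neither veto players nor null players. -/
def IsNontrivial {N : Type*} [Fintype N] (G : SimpleGame N) : Prop :=
  ∀ i, ¬ G.IsVeto i ∧ ¬ G.IsNull i

/-- `𝒲ᵢ`, the winning coalitions that contain player `i`. -/
def winningWith {N : Type*} [Fintype N] (G : SimpleGame N) (i : N) : Set (Finset N) :=
  {S | S ∈ G.winning ∧ i ∈ S}

/-- The desirability relation `i ≿ j`: the transposition of `i` and `j` maps `𝒲ⱼ` into `𝒲ᵢ`. -/
def Desirable {N : Type*} [Fintype N] [DecidableEq N] (G : SimpleGame N) (i j : N) : Prop :=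
  (fun S : Finset N => S.map (Equiv.swap i j).toEmbedding) '' G.winningWith j ⊆ G.winningWith i

theorem desirable_iff {N : Type*} [Fintype N] [DecidableEq N] (G : SimpleGame N) (i j : N) :
    G.Desirable i j ↔
      ∀ S ∈ G.winning, j ∈ S → i ∉ S → insert i (S.erase j) ∈ G.winning := by
  have key : ∀ S : Finset N, j ∈ S → i ∉ S →
      S.map (Equiv.swap i j).toEmbedding = insert i (S.erase j) := by
    intro S hj hi
    ext x
    rw [Finset.mem_map_equiv, Equiv.symm_swap, Finset.mem_insert, Finset.mem_erase]
    by_cases h1 : x = i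
    · subst h1; simp [hj]
    · by_cases h2 : x = j
      · subst h2; simp [hi, h1]
      · simp [Equiv.swap_apply_of_ne_of_ne h1 h2, h1, h2]
  have key2 : ∀ S : Finset N, j ∈ S → i ∈ S → S.map (Equiv.swap i j).toEmbedding = S := by
    intro S hj hi
    ext x
    rw [Finset.mem_map_equiv, Equiv.symm_swap]
    by_cases h1 : x = i
    · subst h1; simp [hj, hi]
    · by_cases h2 : x = j
      · subst h2; simp [hi, hj]
      · simp [Equiv.swap_apply_of_ne_of_ne h1 h2]
  constructor
  · intro h S hS hj hi
    have := h ⟨S, ⟨hS, hj⟩, rfl⟩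
    simp only [key S hj hi] at this
    exact this.1
  · rintro h _ ⟨S, ⟨hS, hj⟩, rfl⟩
    by_cases hi : i ∈ S
    · simp only [key2 S hj hi]; exact ⟨hS, hi⟩
    · simp only [key S hj hi]; exact ⟨h S hS hj hi, Finset.mem_insert_self _ _⟩

theorem desirable_refl {N : Type*} [Fintype N] [DecidableEq N] (G : SimpleGame N) (i : N) :
    G.Desirable i i := by
  rw [desirable_iff]; intro S _ h h'; exact absurd h h'

theorem desirable_trans {N : Type*} [Fintype N] [DecidableEq N] (G : SimpleGame N) {i j k : N}
    (hij : G.Desirable i j) (hjk : G.Desirable j k) : G.Desirable i k := by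
  by_cases e1 : i = j
  · subst e1; exact hjk
  by_cases e2 : j = k
  · subst e2; exact hij
  rw [desirable_iff] at *
  intro S hS hk hi
  have e3 : i ≠ k := by rintro rfl; exact hi hk
  by_cases hj : j ∈ S
  · have h1 := hij S hS hj hi
    have h2 := hjk _ h1 (by simp [hk, Ne.symm e2]) (by simp [Ne.symm e1])
    convert h2 using 1
    ext x
    simp only [Finset.mem_insert, Finset.mem_erase]
    by_cases hx : x = j
    · subst hx; simp [hj, e2]
    · by_cases hx' : x = i
      · subst hx'; simp [e3]
      · simp [hx, hx']
  · have h1 := hjk S hS hk hj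
    have h2 := hij _ h1 (by simp) (by simp [e1, hi])
    convert h2 using 1
    rw [Finset.erase_insert (by simp [hj])]

/-- Equi-desirability `i ≈ j`: `i ≿ j` and `j ≿ i`. -/
def equiDesirable {N : Type*} [Fintype N] [DecidableEq N] (G : SimpleGame N) : Setoid N where
  r i j := G.Desirable i j ∧ G.Desirable j i
  iseqv :=
    { refl := fun i => ⟨G.desirable_refl i, G.desirable_refl i⟩
      symm := fun h => ⟨h.2, h.1⟩
      trans := fun h h' => ⟨G.desirable_trans h.1 h'.1, G.desirable_trans h'.2 h.2⟩ }

/-- The equivalence classes of equi-desirable players. -/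
abbrev PlayerClass {N : Type*} [Fintype N] [DecidableEq N] (G : SimpleGame N) : Type _ :=
  Quotient G.equiDesirable

noncomputable instance instFintypePlayerClass {N : Type*} [Fintype N] [DecidableEq N]
    (G : SimpleGame N) : Fintype G.PlayerClass := Fintype.ofFinite _

/-- The class of a player. -/
def classOf {N : Type*} [Fintype N] [DecidableEq N] (G : SimpleGame N) (i : N) :
    G.PlayerClass := Quotient.mk _ i

/-- The ordering of classes: `p` is at least as strong as `c` if `i ≿ j` for all members
`i` of `p` and `j` of `c`. It is a linear order when any two players are comparable, in
particular for weighted games. -/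
def ClassGe {N : Type*} [Fintype N] [DecidableEq N] (G : SimpleGame N)
    (p c : G.PlayerClass) : Prop :=
  ∀ i j, G.classOf i = p → G.classOf j = c → G.Desirable i j

open Classical in
/-- The type of a coalition: how many members it has in each class. -/
noncomputable def coalitionType {N : Type*} [Fintype N] [DecidableEq N] (G : SimpleGame N)
    (S : Finset N) : G.PlayerClass → ℕ :=
  fun c => (S.filter (fun i => G.classOf i = c)).card

/-- The admissible vectors: `0 ≤ m_c ≤ |c|` for every class `c`. -/
def IsVector {N : Type*} [Fintype N] [DecidableEq N] (G : SimpleGame N)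
    (m : G.PlayerClass → ℕ) : Prop :=
  ∀ c, m c ≤ G.coalitionType Finset.univ c

/-- Winning vectors: the coalitions of this type are winning. -/
def IsWinningVector {N : Type*} [Fintype N] [DecidableEq N] (G : SimpleGame N)
    (m : G.PlayerClass → ℕ) : Prop :=
  G.IsVector m ∧ ∀ S, G.coalitionType S = m → S ∈ G.winning

/-- Losing vectors: the coalitions of this type are losing. -/
def IsLosingVector {N : Type*} [Fintype N] [DecidableEq N] (G : SimpleGame N)
    (m : G.PlayerClass → ℕ) : Prop :=
  G.IsVector m ∧ ∀ S, G.coalitionType S = m → S ∉ G.winning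

open Classical in
/-- `a ⪰ b`: for every class `c`, the sum of the entries of `a` over the classes from the
strongest one down to `c` is at least the corresponding sum for `b`. -/
def VectorGe {N : Type*} [Fintype N] [DecidableEq N] (G : SimpleGame N)
    (a b : G.PlayerClass → ℕ) : Prop :=
  ∀ c, ∑ p with G.ClassGe p c, b p ≤ ∑ p with G.ClassGe p c, a p

/-- Shift-minimal winning vectors: winning, and all strictly smaller vectors are losing. -/
def IsShiftMinimalWinningVector {N : Type*} [Fintype N] [DecidableEq N] (G : SimpleGame N)
    (m : G.PlayerClass → ℕ) : Prop :=
  G.IsWinningVector m ∧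
    ∀ m', G.IsVector m' → G.VectorGe m m' → m' ≠ m → G.IsLosingVector m'

/-- The number `t` of equivalence classes. -/
noncomputable def numClasses {N : Type*} [Fintype N] [DecidableEq N] (G : SimpleGame N) : ℕ :=
  Fintype.card G.PlayerClass

/-- The number `r` of shift-minimal winning vectors. -/
noncomputable def numShiftMinimal {N : Type*} [Fintype N] [DecidableEq N]
    (G : SimpleGame N) : ℕ :=
  {m | G.IsShiftMinimalWinningVector m}.ncard

/-- Isomorphism of simple games: a bijection of the players that preserves and reflects
winning coalitions. -/
def Isomorphic {N N' : Type*} [Fintype N] [Fintype N'] (G : SimpleGame N)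
    (G' : SimpleGame N') : Prop :=
  ∃ f : N ≃ N', ∀ S : Finset N, S ∈ G.winning ↔ S.map f.toEmbedding ∈ G'.winning

/-- Isomorphism as an equivalence relation on the games with player set `N`. -/
def isoSetoid (N : Type*) [Fintype N] : Setoid (SimpleGame N) where
  r := Isomorphic
  iseqv :=
    { refl := fun G => ⟨Equiv.refl N, fun S => by simp⟩
      symm := by
        rintro G G' ⟨f, hf⟩
        refine ⟨f.symm, fun S => ?_⟩
        rw [hf]
        have : (S.map f.symm.toEmbedding).map f.toEmbedding = S := by
          ext x; simp [Finset.mem_map_equiv]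
        rw [this]
      trans := by
        rintro G G' G'' ⟨f, hf⟩ ⟨g, hg⟩
        refine ⟨f.trans g, fun S => ?_⟩
        rw [hf, hg, Finset.map_map]
        rfl }

end SimpleGame

/-- The number of isomorphism classes of weighted games with `n` players, `t` equivalence
classes and `r` shift-minimal winning vectors. -/
noncomputable def wg (n t r : ℕ) : ℕ :=
  (Quotient.mk (SimpleGame.isoSetoid (Fin n)) ''
    {G | G.IsWeighted ∧ G.numClasses = t ∧ G.numShiftMinimal = r}).ncard

/-- The number of isomorphism classes of non-trivial weighted games with `n` players, `t`
equivalence classes and `r` shift-minimal winning vectors. -/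
noncomputable def wgNontrivial (n t r : ℕ) : ℕ :=
  (Quotient.mk (SimpleGame.isoSetoid (Fin n)) ''
    {G | G.IsWeighted ∧ G.IsNontrivial ∧ G.numClasses = t ∧ G.numShiftMinimal = r}).ncard

/-! The games in question correspond to binary words, and the counts are counts of words in a
regular language.

A weighted game is complete, and a complete game has exactly one shift-minimal winning vector iff
some winning coalition is dominated by all the others (`IsComplete.numShiftMinimal_eq_one_iff`).
Sort the players by decreasing weight and choose the least winning coalition `T` whose members come
last inside each class. Then a coalition wins iff each prefix of the player order contains at least
as many of its members as members of `T` (`exists_winning_eq_prefixGame`), so the indicator word of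
`T` determines the game. Conversely the game determines the word: the number of ones among the first
k letters is the maximum over k-sets `A` of the minimum of |S ∩ A| over winning `S`
(`prefixGame.eq_of_isomorphic`). Isomorphism classes thus become words with at least one 1. The
number of classes is one more than the number of factors 10 (`prefixGame.numClasses_eq`), and
non-trivial games are those whose word begins with 0 and ends with 1
(`prefixGame.isNontrivial_iff`).

The game is weighted iff the word has the form 1ᵖ 0ᵃ 1ᵇ 0ᶜ 1ᵈ 0ᵉ with c ≤ 1 or d ≤ 1
(`prefixGame.isWeighted_iff`). For such words explicit weights exist; any other word contains 010011
or 010101 as a subsequence, which yields two winning and two losing coalitions with the same total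
weight. A finite automaton (`Phase`) recognises these words and also records descents and the last
letter. The number of words ending in each state other than `bad` is polynomial in n from n = 3 on
(`phaseSum.eq_false`, `phaseSum.eq_true`), and the formulas are sums of these polynomials. -/

namespace SimpleGame

/-! ### Dominance and shift-minimal vectors in complete games -/

section General

variable {N : Type*} [Fintype N] [DecidableEq N] (G : SimpleGame N)

open Classical in
/-- The players at least as desirable as `j`. -/
noncomputable def upperSet (j : N) : Finset N := Finset.univ.filter fun i => G.Desirable i j

/-- Dominance of coalitions: `S` meets every upper set at least as often as `T`. -/
def Dominates (S T : Finset N) : Prop :=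
  ∀ j, (T ∩ G.upperSet j).card ≤ (S ∩ G.upperSet j).card

variable {G}

theorem mem_upperSet {i j : N} : i ∈ G.upperSet j ↔ G.Desirable i j := by
  simp [upperSet]

theorem Dominates.trans {S T U : Finset N} (h : G.Dominates S T) (h' : G.Dominates T U) :
    G.Dominates S U := fun j => (h' j).trans (h j)

theorem classOf_eq_iff {i j : N} :
    G.classOf i = G.classOf j ↔ G.Desirable i j ∧ G.Desirable j i :=
  Quotient.eq (r := G.equiDesirable)

theorem classGe_classOf {i j : N} :
    G.ClassGe (G.classOf i) (G.classOf j) ↔ G.Desirable i j := by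
  constructor
  · intro h; exact h i j rfl rfl
  · intro h i' j' hi hj
    rw [classOf_eq_iff] at hi hj
    exact G.desirable_trans hi.1 (G.desirable_trans h hj.2)

open Classical in
theorem sum_coalitionType (S : Finset N) (j : N) :
    ∑ p with G.ClassGe p (G.classOf j), G.coalitionType S p = (S ∩ G.upperSet j).card := by
  unfold coalitionType
  rw [← Finset.card_biUnion]
  · congr 1
    ext i
    simp only [Finset.mem_biUnion, Finset.mem_filter, Finset.mem_univ, true_and,
      Finset.mem_inter, mem_upperSet]
    constructor
    · rintro ⟨p, hp, hi, rfl⟩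
      exact ⟨hi, classGe_classOf.1 hp⟩
    · rintro ⟨hi, h⟩
      exact ⟨_, classGe_classOf.2 h, hi, rfl⟩
  · intro p _ q _ hpq
    simp only [Function.onFun]
    rw [Finset.disjoint_left]
    intro i hi hi'
    simp only [Finset.mem_filter] at hi hi'
    exact hpq (hi.2.symm.trans hi'.2)

theorem vectorGe_coalitionType {S T : Finset N} :
    G.VectorGe (G.coalitionType S) (G.coalitionType T) ↔ G.Dominates S T := by
  constructor
  · intro h j
    have := h (G.classOf j)
    rwa [sum_coalitionType, sum_coalitionType] at this
  · intro h c
    obtain ⟨j, rfl⟩ := Quotient.exists_rep c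
    have := h j
    rw [← sum_coalitionType, ← sum_coalitionType] at this
    exact this

theorem isVector_coalitionType (S : Finset N) : G.IsVector (G.coalitionType S) := by
  classical
  intro c
  exact Finset.card_le_card (Finset.filter_subset_filter _ (Finset.subset_univ _))

open Classical in
theorem IsVector.exists_coalition {m : G.PlayerClass → ℕ} (hm : G.IsVector m) :
    ∃ S, G.coalitionType S = m := by
  have h := fun c => Finset.exists_subset_card_eq (hm c)
  choose f hf hc using h
  refine ⟨Finset.univ.filter fun i => i ∈ f (G.classOf i), ?_⟩
  funext c
  rw [← hc c]
  unfold coalitionType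
  congr 1
  ext i
  simp only [Finset.mem_filter, Finset.mem_univ, true_and]
  constructor
  · rintro ⟨h, rfl⟩; exact h
  · intro h
    have := (Finset.mem_filter.1 (hf c h)).2
    rw [this]; exact ⟨h, rfl⟩

/-- Coalitions of the same type have the same status. -/
theorem winning_of_coalitionType_eq {S T : Finset N} (hS : S ∈ G.winning)
    (h : G.coalitionType S = G.coalitionType T) : T ∈ G.winning := by
  classical
  induction hk : (S \ T).card using Nat.strong_induction_on generalizing S with
  | _ k ih =>
    by_cases hST : S ⊆ T
    · exact G.mono S T hS hST
    · obtain ⟨i, hiS, hiT⟩ := Finset.not_subset.1 hST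
      have hc := congrFun h (G.classOf i)
      have : ∃ j ∈ T, j ∉ S ∧ G.classOf j = G.classOf i := by
        by_contra hcon
        push Not at hcon
        have hlt : G.coalitionType T (G.classOf i) < G.coalitionType S (G.classOf i) := by
          unfold coalitionType
          apply Finset.card_lt_card
          rw [Finset.ssubset_iff_of_subset]
          · exact ⟨i, by simp [hiS], by simp [hiT]⟩
          · intro j hj
            simp only [Finset.mem_filter] at hj ⊢
            refine ⟨?_, hj.2⟩
            by_contra hjS
            exact hcon j hj.1 hjS hj.2
        omega
      -- Exchanging `i` for the equivalent `j` keeps the type and the win, and brings `S` one step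
      -- closer to `T`.
      obtain ⟨j, hjT, hjS, hji⟩ := this
      have hji' := classOf_eq_iff.1 hji
      have hw := (G.desirable_iff j i).1 hji'.1 S hS hiS hjS
      have hij : i ≠ j := by rintro rfl; exact hjS hiS
      refine ih _ ?_ hw ?_ rfl
      · rw [← hk]
        apply Finset.card_lt_card
        rw [Finset.ssubset_iff_of_subset]
        · exact ⟨i, by simp [hiS, hiT], by simp [hij]⟩
        · intro x hx
          simp only [Finset.mem_sdiff, Finset.mem_insert, Finset.mem_erase] at hx ⊢
          rcases hx with ⟨rfl | hx, hxT⟩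
          · exact absurd hjT hxT
          · exact ⟨hx.2, hxT⟩
      · rw [← h]
        funext c
        unfold coalitionType
        by_cases hcc : G.classOf i = c
        · rw [Finset.filter_insert, if_pos (hji.trans hcc), Finset.filter_erase,
            Finset.card_insert_of_notMem (by simp [hjS]),
            Finset.card_erase_of_mem (by simp [hiS, hcc])]
          have : 0 < (S.filter fun x => G.classOf x = c).card :=
            Finset.card_pos.2 ⟨i, by simp [hiS, hcc]⟩
          omega
        · rw [Finset.filter_insert, if_neg (by rwa [hji]), Finset.filter_erase,
            Finset.erase_eq_of_notMem (by simp [hcc])]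

variable (G) in
/-- Any two players are comparable. -/
def IsComplete : Prop := ∀ i j, G.Desirable i j ∨ G.Desirable j i

theorem upperSet_subset {i j : N} (h : G.Desirable i j) : G.upperSet i ⊆ G.upperSet j := by
  intro k hk
  rw [mem_upperSet] at *
  exact G.desirable_trans hk h

open Classical in
/-- The players strictly more desirable than `j` form an upper set, unless there are none. -/
theorem IsComplete.exists_upperSet_eq (hG : G.IsComplete) (j : N) :
    (Finset.univ.filter fun i => ¬ G.Desirable j i) = ∅ ∨
      ∃ v, (Finset.univ.filter fun i => ¬ G.Desirable j i) = G.upperSet v := by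
  rcases Finset.eq_empty_or_nonempty (Finset.univ.filter fun i => ¬ G.Desirable j i) with h | h
  · exact Or.inl h
  right
  -- `v` is a weakest player among those strictly above `j`.
  obtain ⟨v, hv, hmax⟩ := Finset.exists_max_image _ (fun v => (G.upperSet v).card) h
  refine ⟨v, ?_⟩
  ext i
  simp only [Finset.mem_filter, Finset.mem_univ, true_and, mem_upperSet] at hv hmax ⊢
  constructor
  · intro hi
    by_contra hiv
    have hvi := (hG i v).resolve_left hiv
    have : (G.upperSet v).card < (G.upperSet i).card := by
      apply Finset.card_lt_card
      rw [Finset.ssubset_iff_of_subset (upperSet_subset hvi)]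
      exact ⟨i, mem_upperSet.2 (G.desirable_refl i), fun h => hiv (mem_upperSet.1 h)⟩
    exact absurd (hmax i hi) (by omega)
  · intro hi hji
    exact hv (G.desirable_trans hji hi)

/-- Dominance is antisymmetric on types: in a complete game a class is the difference of two
consecutive upper sets, so the counts in upper sets determine the counts in classes. -/
theorem IsComplete.coalitionType_eq (hG : G.IsComplete) {S T : Finset N}
    (h : G.Dominates S T) (h' : G.Dominates T S) : G.coalitionType S = G.coalitionType T := by
  classical
  have hU : ∀ j, (S ∩ G.upperSet j).card = (T ∩ G.upperSet j).card :=
    fun j => le_antisymm (h' j) (h j)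
  funext c
  obtain ⟨j, rfl⟩ := Quotient.exists_rep c
  set V := Finset.univ.filter fun i => ¬ G.Desirable j i with hV
  have hVc : (S ∩ V).card = (T ∩ V).card := by
    rcases hG.exists_upperSet_eq j with h | ⟨v, h⟩
    · rw [hV, h]; simp
    · rw [hV, h]; exact hU v
  have key : ∀ X : Finset N,
      (X ∩ G.upperSet j).card = G.coalitionType X (G.classOf j) + (X ∩ V).card := by
    intro X
    unfold coalitionType
    rw [← Finset.card_union_of_disjoint]
    · congr 1
      ext i
      simp only [Finset.mem_inter, mem_upperSet, Finset.mem_union, Finset.mem_filter, hV,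
        Finset.mem_univ, true_and, classOf_eq_iff]
      have := hG i j
      tauto
    · rw [Finset.disjoint_left]
      intro i hi hi'
      simp only [Finset.mem_inter, Finset.mem_filter, hV,
        Finset.mem_univ, true_and, classOf_eq_iff] at hi hi'
      exact hi'.2 hi.2.2
  have h1 := key S
  have h2 := key T
  have h3 := hU j
  change G.coalitionType S (G.classOf j) = G.coalitionType T (G.classOf j)
  omega

/-- A complete game has one shift-minimal winning vector if and only if it has a least winning
coalition with respect to dominance. -/
theorem IsComplete.numShiftMinimal_eq_one_iff (hG : G.IsComplete) :
    G.numShiftMinimal = 1 ↔ ∃ S₀ ∈ G.winning, ∀ S ∈ G.winning, G.Dominates S S₀ := by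
  classical
  unfold numShiftMinimal
  rw [Set.ncard_eq_one]
  constructor
  · rintro ⟨m, hm⟩
    have hmm : G.IsShiftMinimalWinningVector m := by
      have : m ∈ ({m} : Set _) := rfl
      rwa [← hm] at this
    obtain ⟨S₀, hS₀⟩ := hmm.1.1.exists_coalition
    refine ⟨S₀, hmm.1.2 _ hS₀, ?_⟩
    intro S hS
    -- Descent to the minimal vector: if the type of `S` is not shift-minimal, some winning
    -- coalition lies strictly below `S`, and the sum of the counts in all upper sets drops.
    induction hk : ∑ j, (S ∩ G.upperSet j).card using Nat.strong_induction_on generalizing S with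
    | _ k ih =>
      by_cases hsm : G.IsShiftMinimalWinningVector (G.coalitionType S)
      · have : G.coalitionType S ∈ {m | G.IsShiftMinimalWinningVector m} := hsm
        rw [hm] at this
        rw [← vectorGe_coalitionType, hS₀, Set.mem_singleton_iff.1 this]
        exact fun c => le_rfl
      · have hw : G.IsWinningVector (G.coalitionType S) :=
          ⟨isVector_coalitionType S, fun T hT => winning_of_coalitionType_eq hS hT.symm⟩
        unfold IsShiftMinimalWinningVector at hsm
        push Not at hsm
        obtain ⟨m', hm', hge, hne, hl⟩ := hsm hw
        unfold IsLosingVector at hl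
        push Not at hl
        obtain ⟨S', hS', hS'w⟩ := hl hm'
        subst hS'
        rw [vectorGe_coalitionType] at hge
        refine hge.trans (ih _ ?_ S' hS'w rfl)
        rw [← hk]
        apply lt_of_le_of_ne (Finset.sum_le_sum fun j _ => hge j)
        intro heq
        rw [Finset.sum_eq_sum_iff_of_le (fun j _ => hge j)] at heq
        exact hne (hG.coalitionType_eq (fun j => (heq j (Finset.mem_univ _)).ge) hge)
  · rintro ⟨S₀, hS₀, hmin⟩
    refine ⟨G.coalitionType S₀, ?_⟩
    have hw : G.IsWinningVector (G.coalitionType S₀) :=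
      ⟨isVector_coalitionType S₀, fun T hT => winning_of_coalitionType_eq hS₀ hT.symm⟩
    ext m
    simp only [Set.mem_ofPred_eq, Set.mem_singleton_iff]
    constructor
    · intro hm
      by_contra hne
      obtain ⟨S, rfl⟩ := hm.1.1.exists_coalition
      have := hm.2 _ hw.1 (vectorGe_coalitionType.2 (hmin S (hm.1.2 S rfl))) (Ne.symm hne)
      exact this.2 S₀ rfl hS₀
    · rintro rfl
      refine ⟨hw, fun m' hm' hge hne => ⟨hm', ?_⟩⟩
      rintro S rfl hS
      rw [vectorGe_coalitionType] at hge
      exact hne (hG.coalitionType_eq (hmin S hS) hge)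

theorem IsWeighted.isComplete (hG : G.IsWeighted) : G.IsComplete := by
  obtain ⟨w, q, _, _, h⟩ := hG
  have key : ∀ i j, w j ≤ w i → G.Desirable i j := by
    intro i j hij
    rw [desirable_iff]
    intro S hS hj hi
    rw [h] at hS ⊢
    rw [Finset.sum_insert (by simp [hi])]
    have := Finset.add_sum_erase S w hj
    linarith
  intro i j
  rcases le_total (w i) (w j) with h | h
  · exact Or.inr (key _ _ h)
  · exact Or.inl (key _ _ h)

end General

/-! ### Invariance under isomorphism -/

section Isomorphism

variable {N N' : Type*} [Fintype N] [Fintype N'] {G : SimpleGame N} {G' : SimpleGame N'}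

theorem Isomorphic.symm (h : G.Isomorphic G') : G'.Isomorphic G := by
  obtain ⟨f, hf⟩ := h
  refine ⟨f.symm, fun S => ?_⟩
  rw [hf, Finset.map_map]
  simp

theorem Isomorphic.isWeighted (h : G.Isomorphic G') (hG : G.IsWeighted) : G'.IsWeighted := by
  obtain ⟨f, hf⟩ := h.symm
  obtain ⟨w, q, hw, hq, h⟩ := hG
  refine ⟨w ∘ f, q, fun i => hw _, hq, fun S => ?_⟩
  rw [hf, h, Finset.sum_map]
  rfl

theorem Isomorphic.isNontrivial (h : G.Isomorphic G') (hG : G.IsNontrivial) :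
    G'.IsNontrivial := by
  obtain ⟨f, hf⟩ := h
  intro i
  have hsymm : ∀ T : Finset N', T = (T.map f.symm.toEmbedding).map f.toEmbedding := by
    intro T; rw [Finset.map_map]; simp
  refine ⟨fun hv => (hG (f.symm i)).1 ?_, fun hn => (hG (f.symm i)).2 ?_⟩
  · intro S hS
    have := hv _ ((hf S).1 hS)
    simpa [Finset.mem_map_equiv] using this
  · intro S hS hi
    refine hn (S.map f.toEmbedding) ⟨(hf S).1 hS.1, fun T hT hTw => ?_⟩ (by
      simpa [Finset.mem_map_equiv] using hi)
    rw [hsymm T, ← hf] at hTw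
    rw [hsymm T, Finset.map_ssubset_map] at hT
    exact hS.2 _ hT hTw

variable [DecidableEq N] [DecidableEq N']

theorem desirable_of_equiv {f : N ≃ N'}
    (hf : ∀ S : Finset N, S ∈ G.winning ↔ S.map f.toEmbedding ∈ G'.winning) {i j : N}
    (h : G'.Desirable (f i) (f j)) : G.Desirable i j := by
  rw [desirable_iff] at *
  intro S hS hj hi
  rw [hf, Finset.map_insert, Finset.map_erase]
  exact h _ ((hf S).1 hS) (by simpa using hj) (by simpa using hi)

theorem desirable_equiv_iff {f : N ≃ N'}
    (hf : ∀ S : Finset N, S ∈ G.winning ↔ S.map f.toEmbedding ∈ G'.winning) {i j : N} :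
    G'.Desirable (f i) (f j) ↔ G.Desirable i j := by
  refine ⟨desirable_of_equiv hf, fun h => ?_⟩
  apply desirable_of_equiv (f := f.symm) (G' := G)
  · intro S
    rw [hf, Finset.map_map]
    simp
  · simpa using h

theorem Isomorphic.numClasses_eq (h : G.Isomorphic G') : G.numClasses = G'.numClasses := by
  obtain ⟨f, hf⟩ := h
  refine Fintype.card_congr (Quotient.congr f ?_)
  intro i j
  exact and_congr (desirable_equiv_iff hf).symm (desirable_equiv_iff hf).symm

/-- Only the value one is needed, so it suffices to transport a least winning coalition instead of
the vectors themselves. -/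
theorem Isomorphic.numShiftMinimal_eq_one (h : G.Isomorphic G') (hG : G.IsWeighted)
    (h1 : G.numShiftMinimal = 1) : G'.numShiftMinimal = 1 := by
  have hc' := (h.isWeighted hG).isComplete
  rw [hG.isComplete.numShiftMinimal_eq_one_iff] at h1
  rw [hc'.numShiftMinimal_eq_one_iff]
  obtain ⟨f, hf⟩ := h
  obtain ⟨S₀, hS₀, hmin⟩ := h1
  have key : ∀ (S : Finset N) (j : N),
      (S.map f.toEmbedding ∩ G'.upperSet (f j)).card = (S ∩ G.upperSet j).card := by
    intro S j
    have : G'.upperSet (f j) = (G.upperSet j).map f.toEmbedding := by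
      ext i
      obtain ⟨i, rfl⟩ := f.surjective i
      simp only [mem_upperSet, Finset.mem_map_equiv, Equiv.symm_apply_apply]
      exact desirable_equiv_iff hf
    rw [this, ← Finset.map_inter, Finset.card_map]
  refine ⟨S₀.map f.toEmbedding, (hf _).1 hS₀, fun S hS j => ?_⟩
  obtain ⟨j, rfl⟩ := f.surjective j
  have hSS : S = (S.map f.symm.toEmbedding).map f.toEmbedding := by
    rw [Finset.map_map]; simp
  rw [hSS, ← hf] at hS
  rw [hSS, key, key]
  exact hmin _ hS j

end Isomorphism

end SimpleGame

/-! ### Prefix counts of sets of natural numbers -/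

/-- The number of elements of `T` below `k`. -/
def prefixCount (T : Finset ℕ) (k : ℕ) : ℕ := Nat.count (· ∈ T) k

namespace prefixCount

variable {T U : Finset ℕ} {a k l n : ℕ}

@[simp] theorem zero : prefixCount T 0 = 0 := Nat.count_zero _

theorem succ : prefixCount T (k + 1) = prefixCount T k + if k ∈ T then 1 else 0 :=
  Nat.count_succ _ _

theorem succ_of_mem (h : k ∈ T) : prefixCount T (k + 1) = prefixCount T k + 1 := by
  rw [succ, if_pos h]

theorem succ_of_notMem (h : k ∉ T) : prefixCount T (k + 1) = prefixCount T k := by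
  rw [succ, if_neg h, add_zero]

theorem le_self : prefixCount T k ≤ k := Nat.count_le _

theorem mono (h : k ≤ l) : prefixCount T k ≤ prefixCount T l := Nat.count_monotone _ h

theorem le_add (h : k ≤ l) : prefixCount T l ≤ prefixCount T k + (l - k) := by
  obtain ⟨d, rfl⟩ := Nat.exists_eq_add_of_le h
  unfold prefixCount
  rw [Nat.count_add]
  have := Nat.count_le (p := fun x => k + x ∈ T) (n := d)
  omega

theorem mono_set (h : T ⊆ U) : prefixCount T k ≤ prefixCount U k :=
  Nat.count_mono_left fun _ _ hx => h hx

theorem empty : prefixCount ∅ k = 0 := by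
  simp [prefixCount]

theorem insert (h : a ∉ T) :
    prefixCount (insert a T) k = prefixCount T k + if a < k then 1 else 0 := by
  induction k with
  | zero => simp
  | succ k ih =>
    rw [succ, succ, ih]
    by_cases hk : k = a
    · subst hk; simp [h]
    · have : (a < k + 1) ↔ a < k := by omega
      simp only [Finset.mem_insert, hk, false_or, this]
      omega

theorem erase (h : a ∈ T) :
    prefixCount (T.erase a) k + (if a < k then 1 else 0) = prefixCount T k := by
  rw [← insert (Finset.notMem_erase a T), Finset.insert_erase h]

theorem eq_card (h : T ⊆ Finset.range n) : prefixCount T n = T.card := by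
  unfold prefixCount
  rw [Nat.count_eq_card_filter_range, Finset.filter_mem_eq_inter,
    Finset.inter_eq_right.2 h]

theorem eq_card_filter : prefixCount T k = (T.filter (· < k)).card := by
  unfold prefixCount
  rw [Nat.count_eq_card_filter_range]
  congr 1
  ext x
  simp [and_comm]

theorem pos (hT : T.Nonempty) (h : T ⊆ Finset.range n) : 0 < prefixCount T n := by
  rw [eq_card h]; exact hT.card_pos

theorem ext_of_forall_eq (hT : T ⊆ Finset.range n) (hU : U ⊆ Finset.range n)
    (h : ∀ k ≤ n, prefixCount T k = prefixCount U k) : T = U := by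
  ext a
  by_cases ha : a < n
  · have h1 := h a (by omega)
    have h2 := h (a + 1) (by omega)
    rw [succ, succ] at h2
    by_cases hT : a ∈ T <;> by_cases hU : a ∈ U <;> simp_all
  · exact iff_of_false (fun h => ha (Finset.mem_range.1 (hT h)))
      fun h => ha (Finset.mem_range.1 (hU h))

end prefixCount

/-! ### Games defined by a binary word, with players in decreasing order of strength -/

/-- The coalition of `Fin n` consisting of the players with index in `U`. -/
def finCoalition (n : ℕ) (U : Finset ℕ) : Finset (Fin n) := Finset.univ.filter fun i => i.val ∈ U

theorem map_finCoalition {n : ℕ} {U : Finset ℕ} (h : U ⊆ Finset.range n) :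
    (finCoalition n U).map Fin.valEmbedding = U := by
  ext a
  simp only [finCoalition, Finset.mem_map, Finset.mem_filter, Finset.mem_univ, true_and,
    Fin.valEmbedding_apply]
  constructor
  · rintro ⟨i, hi, rfl⟩; exact hi
  · intro ha; exact ⟨⟨a, Finset.mem_range.1 (h ha)⟩, ha, rfl⟩

theorem map_val_subset {n : ℕ} (S : Finset (Fin n)) :
    S.map Fin.valEmbedding ⊆ Finset.range n := by
  intro a ha
  obtain ⟨i, _, rfl⟩ := Finset.mem_map.1 ha
  exact Finset.mem_range.2 i.isLt

theorem val_mem_map {n : ℕ} {S : Finset (Fin n)} {i : Fin n} :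
    (i : ℕ) ∈ S.map Fin.valEmbedding ↔ i ∈ S :=
  Finset.mem_map' Fin.valEmbedding

/-- The game on `Fin n` in which a coalition wins if each of its prefixes is at least as large as
the prefix of `T`. -/
def prefixGame (n : ℕ) (T : Finset ℕ) (hT : 0 < prefixCount T n) : SimpleGame (Fin n) where
  winning := {S | ∀ k ≤ n, prefixCount T k ≤ prefixCount (S.map Fin.valEmbedding) k}
  empty_notMem := by
    intro h
    have := h n le_rfl
    rw [Finset.map_empty, prefixCount.empty] at this
    omega
  univ_mem := by
    intro k hk
    have h1 : prefixCount (Finset.univ.map (Fin.valEmbedding (n := n))) k = k := by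
      have h2 := prefixCount.le_add (T := Finset.univ.map (Fin.valEmbedding (n := n))) hk
      rw [prefixCount.eq_card (map_val_subset _)] at h2
      simp only [Finset.card_map, Finset.card_univ, Fintype.card_fin] at h2
      have h3 := prefixCount.le_self (T := Finset.univ.map (Fin.valEmbedding (n := n))) (k := k)
      omega
    rw [h1]
    exact prefixCount.le_self
  mono := fun S S' h hS k hk => (h k hk).trans (prefixCount.mono_set (Finset.map_subset_map.2 hS))

namespace prefixGame

open SimpleGame

variable {n : ℕ} {T : Finset ℕ} {hT : 0 < prefixCount T n}

theorem mem_winning {S : Finset (Fin n)} : S ∈ (prefixGame n T hT).winning ↔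
    ∀ k ≤ n, prefixCount T k ≤ prefixCount (S.map Fin.valEmbedding) k := Iff.rfl

theorem finCoalition_mem_winning {U : Finset ℕ} (hU : U ⊆ Finset.range n) :
    finCoalition n U ∈ (prefixGame n T hT).winning ↔
      ∀ k ≤ n, prefixCount T k ≤ prefixCount U k := by
  rw [mem_winning, map_finCoalition hU]

theorem self_mem_winning (hTn : T ⊆ Finset.range n) :
    finCoalition n T ∈ (prefixGame n T hT).winning :=
  (finCoalition_mem_winning hTn).2 fun _ _ => le_rfl

/-- Replacing `j` by `i` in a coalition of `Fin n`, in terms of prefix counts. -/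
theorem prefixCount_exchange {S : Finset (Fin n)} {i j : Fin n} (hj : j ∈ S) (hi : i ∉ S)
    (k : ℕ) :
    prefixCount ((insert i (S.erase j)).map Fin.valEmbedding) k + (if j.val < k then 1 else 0) =
      prefixCount (S.map Fin.valEmbedding) k + if i.val < k then 1 else 0 := by
  have h1 : (i : ℕ) ∉ (S.map Fin.valEmbedding).erase j := by
    rw [Finset.mem_erase, val_mem_map]
    exact fun h => hi h.2
  have h2 : (j : ℕ) ∈ S.map Fin.valEmbedding := val_mem_map.2 hj
  have h3 := prefixCount.erase (k := k) h2
  rw [Finset.map_insert, Finset.map_erase]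
  change prefixCount (insert (i : ℕ) ((S.map Fin.valEmbedding).erase j)) k + _ = _
  rw [prefixCount.insert h1]
  omega

theorem desirable_of_le {i j : Fin n} (h : i ≤ j) : (prefixGame n T hT).Desirable i j := by
  rw [desirable_iff]
  intro S hS hj hi k hk
  have h1 := prefixCount_exchange hj hi k
  have h2 := hS k hk
  have h3 : (i : ℕ) ≤ j := h
  split_ifs at h1 <;> omega

theorem isComplete : (prefixGame n T hT).IsComplete := fun i j =>
  (le_total i j).imp desirable_of_le desirable_of_le

/-- Replacing `a` by `a + 1` lowers only the prefix count at `a + 1`. At a descent `T` itself has no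
slack there. Elsewhere slack is forced by the constraint at `a` (if `a ∉ T`) or at `a + 2` (if both
are in `T`). -/
theorem desirable_succ_iff (hTn : T ⊆ Finset.range n) {a : ℕ} (ha : a + 1 < n) :
    (prefixGame n T hT).Desirable ⟨a + 1, ha⟩ ⟨a, by omega⟩ ↔ ¬ (a ∈ T ∧ a + 1 ∉ T) := by
  rw [desirable_iff]
  constructor
  · rintro h ⟨h1, h2⟩
    have hj : (⟨a, by omega⟩ : Fin n) ∈ finCoalition n T := by simp [finCoalition, h1]
    have hi : (⟨a + 1, ha⟩ : Fin n) ∉ finCoalition n T := by simp [finCoalition, h2]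
    have h3 := h _ (self_mem_winning hTn) hj hi (a + 1) (by omega)
    have h4 := prefixCount_exchange hj hi (a + 1)
    rw [map_finCoalition hTn] at h4
    rw [if_pos (Nat.lt_succ_self a), if_neg (lt_irrefl _)] at h4
    omega
  · intro h S hS hj hi k hk
    have h1 := prefixCount_exchange hj hi k
    have h2 := hS k hk
    have hj' : a ∈ S.map Fin.valEmbedding := Finset.mem_map.2 ⟨_, hj, rfl⟩
    have hi' : a + 1 ∉ S.map Fin.valEmbedding := by
      intro h
      obtain ⟨x, hx, hxa⟩ := Finset.mem_map.1 h
      exact hi (by rwa [show (⟨a + 1, ha⟩ : Fin n) = x from Fin.ext hxa.symm])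
    by_cases hka : k = a + 1
    · subst hka
      simp only [lt_add_iff_pos_right, zero_lt_one, if_true, lt_self_iff_false, if_false] at h1
      have h3 := prefixCount.succ_of_mem hj'
      have h5 := prefixCount.succ_of_notMem hi'
      by_cases hTa : a ∈ T
      · have hTa' : a + 1 ∈ T := by tauto
        have h4 := hS (a + 1 + 1) (by omega)
        have h6 := prefixCount.succ_of_mem hTa'
        omega
      · have h4 := hS a (by omega)
        have h6 := prefixCount.succ_of_notMem hTa
        omega
    · split_ifs at h1 with h3 h4 <;> simp only at * <;> omega

/-- The number of descents of `T` before `k`: members followed by a non-member. -/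
def _root_.descents (T : Finset ℕ) (k : ℕ) : ℕ := Nat.count (fun a => a ∈ T ∧ a + 1 ∉ T) k

theorem _root_.descents_succ (T : Finset ℕ) (k : ℕ) :
    descents T (k + 1) = descents T k + if k ∈ T ∧ k + 1 ∉ T then 1 else 0 :=
  Nat.count_succ _ _

/-- Stronger players come first, so equivalence of `i` and `j` means equivalence of all neighbours
between them, that is, no descent in between. -/
theorem desirable_iff_descents_eq (hTn : T ⊆ Finset.range n) {i j : Fin n} (h : i ≤ j) :
    (prefixGame n T hT).Desirable j i ↔ descents T i = descents T j := by
  obtain ⟨i, hi⟩ := i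
  obtain ⟨j, hj⟩ := j
  have h : i ≤ j := h
  simp only
  induction j, h using Nat.le_induction with
  | base => simp [desirable_refl]
  | succ j hij ih =>
    have ih := ih (by omega) hij
    have hmono : descents T i ≤ descents T j := Nat.count_monotone _ hij
    rw [descents_succ]
    constructor
    · intro hd
      have h1 := (desirable_succ_iff (hT := hT) hTn hj).1
        (desirable_trans _ hd (desirable_of_le (show (⟨i, hi⟩ : Fin n) ≤ ⟨j, by omega⟩ from hij)))
      have h2 := ih.1 (desirable_trans _ (desirable_of_le
        (show (⟨j, by omega⟩ : Fin n) ≤ ⟨j + 1, hj⟩ from Nat.le_succ j)) hd)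
      rw [if_neg h1]; exact h2
    · intro hd
      split_ifs at hd with h1
      · omega
      · exact desirable_trans _ ((desirable_succ_iff hTn hj).2 h1) (ih.2 hd)

theorem classOf_eq_iff_descents_eq (hTn : T ⊆ Finset.range n) {i j : Fin n} :
    (prefixGame n T hT).classOf i = (prefixGame n T hT).classOf j ↔
      descents T i = descents T j := by
  rw [classOf_eq_iff]
  rcases le_total i j with h | h
  · rw [← desirable_iff_descents_eq (hT := hT) hTn h]
    exact ⟨fun h => h.2, fun h' => ⟨desirable_of_le h, h'⟩⟩
  · rw [eq_comm, ← desirable_iff_descents_eq (hT := hT) hTn h]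
    exact ⟨fun h => h.1, fun h' => ⟨h', desirable_of_le h⟩⟩

theorem exists_descents_eq (T : Finset ℕ) {m d : ℕ} (h : d ≤ descents T m) :
    ∃ k ≤ m, descents T k = d := by
  induction m with
  | zero => exact ⟨0, le_rfl, by simp [descents] at h ⊢; omega⟩
  | succ m ih =>
    by_cases hd : d ≤ descents T m
    · obtain ⟨k, hk, h⟩ := ih hd
      exact ⟨k, by omega, h⟩
    · refine ⟨m + 1, le_rfl, ?_⟩
      rw [descents_succ] at h ⊢
      split_ifs at * <;> omega

/-- The class of a player is labelled by the number of descents before it. Only positions below `n -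
1` count: a final one of the word has no successor among the players. -/
theorem numClasses_eq (hTn : T ⊆ Finset.range n) :
    (prefixGame n T hT).numClasses = descents T (n - 1) + 1 := by
  classical
  have hn : 0 < n := hT.trans_le prefixCount.le_self
  let g : (prefixGame n T hT).PlayerClass → ℕ :=
    Quotient.lift (fun i : Fin n => descents T i) fun i j h =>
      (classOf_eq_iff_descents_eq (hT := hT) hTn).1 (Quotient.sound h)
  have hg : Function.Injective g := by
    intro p q
    induction p using Quotient.inductionOn
    induction q using Quotient.inductionOn
    exact (classOf_eq_iff_descents_eq hTn).2
  have himg : Finset.univ.image g = Finset.range (descents T (n - 1) + 1) := by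
    ext d
    simp only [Finset.mem_image, Finset.mem_univ, true_and, Finset.mem_range]
    constructor
    · rintro ⟨p, rfl⟩
      induction p using Quotient.inductionOn with
      | _ i =>
        have : descents T i ≤ descents T (n - 1) := Nat.count_monotone _ (by omega)
        exact Nat.lt_succ_of_le this
    · intro hd
      obtain ⟨k, hk, h⟩ := exists_descents_eq T (Nat.le_of_lt_succ hd)
      exact ⟨Quotient.mk _ ⟨k, by omega⟩, h⟩
  unfold numClasses
  rw [← Finset.card_univ, ← Finset.card_image_of_injective _ hg, himg, Finset.card_range]

theorem numShiftMinimal_eq_one (hTn : T ⊆ Finset.range n) :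
    (prefixGame n T hT).numShiftMinimal = 1 := by
  rw [isComplete.numShiftMinimal_eq_one_iff]
  refine ⟨_, self_mem_winning hTn, fun S hS j => ?_⟩
  -- Upper sets are initial segments, so dominance over `T` is a subset of the prefix inequalities
  -- that define winning.
  obtain ⟨e, he, hU⟩ : ∃ e ≤ n, ∀ i : Fin n,
      i ∈ (prefixGame n T hT).upperSet j ↔ i.val < e := by
    classical
    have hex : ∃ e, ∀ i : Fin n, i ∈ (prefixGame n T hT).upperSet j → i.val < e :=
      ⟨n, fun i _ => i.isLt⟩
    refine ⟨Nat.find hex, Nat.find_min' hex fun i _ => i.isLt, fun i => ⟨Nat.find_spec hex i, ?_⟩⟩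
    intro hi
    have := Nat.find_min hex hi
    push Not at this
    obtain ⟨x, hx, hix⟩ := this
    rw [mem_upperSet] at *
    exact desirable_trans _ (desirable_of_le hix) hx
  have key : ∀ X : Finset (Fin n), (X ∩ (prefixGame n T hT).upperSet j).card =
      prefixCount (X.map Fin.valEmbedding) e := by
    intro X
    rw [prefixCount.eq_card_filter, Finset.filter_map, Finset.card_map]
    congr 1
    ext i
    simp [hU]
  rw [key, key, map_finCoalition hTn]
  exact hS e he

/-- A coalition of `k` players can be avoided up to `prefixCount T k` of them. -/
theorem exists_winning_card_inter_le (A : Finset (Fin n)) :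
    ∃ S ∈ (prefixGame n T hT).winning, (S ∩ A).card ≤ prefixCount T A.card := by
  set b := prefixCount T A.card with hb
  set B := A.map Fin.valEmbedding with hB
  have hBn : B ⊆ Finset.range n := map_val_subset A
  -- `C` is `A` without its first `b` players. The complement of `C` meets `A` in those `b` players
  -- and still wins.
  set C := B.filter fun x => b ≤ prefixCount B x with hC
  have hCc : ∀ k, prefixCount C k = prefixCount B k - b := by
    intro k
    induction k with
    | zero => simp
    | succ k ih =>
      rw [prefixCount.succ, prefixCount.succ, ih]
      by_cases h : k ∈ B <;> by_cases h' : b ≤ prefixCount B k <;> simp [hC, h, h'] <;> omega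
  have hU : ∀ k ≤ n, prefixCount (Finset.range n \ C) k = k - prefixCount C k := by
    intro k
    induction k with
    | zero => simp
    | succ k ih =>
      intro hk
      rw [prefixCount.succ, prefixCount.succ, ih (by omega)]
      have h1 := prefixCount.le_self (T := C) (k := k)
      have h2 : k < n := by omega
      by_cases h : k ∈ C <;> simp [h, h2] <;> omega
  have hBcard : prefixCount B n = A.card := by
    rw [prefixCount.eq_card hBn, hB, Finset.card_map]
  refine ⟨finCoalition n (Finset.range n \ C),
    (finCoalition_mem_winning Finset.sdiff_subset).2 fun k hk => ?_, ?_⟩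
  · rw [hU k hk, hCc]
    have h1 := prefixCount.le_self (T := B) (k := k)
    have h2 := prefixCount.le_self (T := T) (k := k)
    have h3 := prefixCount.mono (T := B) hk
    -- Up to `A.card` the count of `T` is at most `b`; beyond it, that count grows by at most one
    -- per position.
    rcases le_total k A.card with h | h
    · have := prefixCount.mono (T := T) h
      omega
    · have := prefixCount.le_add (T := T) h
      omega
  · have h1 : (finCoalition n (Finset.range n \ C) ∩ A).map Fin.valEmbedding = B \ C := by
      rw [Finset.map_inter, map_finCoalition Finset.sdiff_subset, ← hB]
      ext x
      have := @hBn x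
      simp only [Finset.mem_inter, Finset.mem_sdiff]
      tauto
    rw [← Finset.card_map Fin.valEmbedding, h1,
      Finset.card_sdiff_of_subset (Finset.filter_subset _ _), ← prefixCount.eq_card hBn,
      ← prefixCount.eq_card ((Finset.filter_subset _ _).trans hBn), hCc]
    omega

/-- A winning coalition of the first game meets the first `k` players at least `prefixCount T k`
times, while in the second game the image of these players can be met by a winning coalition at most
`prefixCount T' k` times. -/
theorem prefixCount_le_of_isomorphic {T' : Finset ℕ} {hT' : 0 < prefixCount T' n}
    (h : (prefixGame n T hT).Isomorphic (prefixGame n T' hT')) {k : ℕ} (hk : k ≤ n) :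
    prefixCount T k ≤ prefixCount T' k := by
  obtain ⟨f, hf⟩ := h
  set K : Finset (Fin n) := finCoalition n (Finset.range k) with hK
  have hKr : Finset.range k ⊆ Finset.range n := Finset.range_subset_range.2 hk
  have hKc : K.card = k := by
    rw [← Finset.card_map Fin.valEmbedding, map_finCoalition hKr, Finset.card_range]
  obtain ⟨S, hS, hSc⟩ :=
    exists_winning_card_inter_le (T := T') (hT := hT') (K.map f.toEmbedding)
  have hSS : S = (S.map f.symm.toEmbedding).map f.toEmbedding := by
    rw [Finset.map_map]; simp
  rw [hSS, ← hf] at hS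
  rw [hSS, ← Finset.map_inter, Finset.card_map, Finset.card_map, hKc] at hSc
  refine (hS k hk).trans (le_of_eq_of_le ?_ hSc)
  rw [prefixCount.eq_card_filter, Finset.filter_map, Finset.card_map]
  congr 1
  ext i
  simp [hK, finCoalition]

theorem eq_of_isomorphic {T' : Finset ℕ} {hT' : 0 < prefixCount T' n}
    (hTn : T ⊆ Finset.range n) (hTn' : T' ⊆ Finset.range n)
    (h : (prefixGame n T hT).Isomorphic (prefixGame n T' hT')) : T = T' :=
  prefixCount.ext_of_forall_eq hTn hTn' fun _ hk =>
    le_antisymm (prefixCount_le_of_isomorphic h hk) (prefixCount_le_of_isomorphic h.symm hk)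

/-- It suffices to look at the strongest and the weakest player: a leading one makes player 0 a veto
player, and a final zero makes the last player null. -/
theorem isNontrivial_iff (hTn : T ⊆ Finset.range n) :
    (prefixGame n T hT).IsNontrivial ↔ 0 ∉ T ∧ n - 1 ∈ T := by
  have hn : 0 < n := hT.trans_le prefixCount.le_self
  constructor
  · intro h
    constructor
    · intro h0
      refine (h ⟨0, hn⟩).1 fun S hS => ?_
      have h1 := hS 1 hn
      rw [show (1 : ℕ) = 0 + 1 from rfl, prefixCount.succ_of_mem h0, prefixCount.succ] at h1
      simp only [prefixCount.zero, zero_add] at h1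
      split_ifs at h1 with h2
      · obtain ⟨x, hx, hx0⟩ := Finset.mem_map.1 h2
        rwa [show (⟨0, hn⟩ : Fin n) = x from Fin.ext hx0.symm]
      · omega
    · by_contra h0
      refine (h ⟨n - 1, by omega⟩).2 fun S hS hmem => ?_
      refine hS.2 _ (Finset.erase_ssubset hmem) fun k hk => ?_
      have hmem' : (n - 1 : ℕ) ∈ S.map Fin.valEmbedding := Finset.mem_map.2 ⟨_, hmem, rfl⟩
      have h1 := prefixCount.erase (k := k) hmem'
      rw [Finset.map_erase, Fin.valEmbedding_apply]
      simp only
      by_cases hkn : k = n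
      · subst hkn
        obtain ⟨m, rfl⟩ : ∃ m, k = m + 1 := ⟨k - 1, by omega⟩
        have h2 := hS.1 m (by omega)
        simp only [Nat.add_sub_cancel] at *
        rw [prefixCount.succ_of_notMem h0]
        rw [prefixCount.succ_of_mem hmem'] at h1
        split_ifs at h1 <;> omega
      · have h2 := hS.1 k hk
        split_ifs at h1 <;> omega
  · rintro ⟨h0, h1⟩ i
    constructor
    · intro hv
      have hmem : Finset.univ.erase i ∈ (prefixGame n T hT).winning := by
        intro k hk
        have h2 : (i : ℕ) ∈ Finset.univ.map (Fin.valEmbedding (n := n)) := by simp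
        have h3 := prefixCount.erase (k := k) h2
        have h6 : k ≤ prefixCount (Finset.univ.map (Fin.valEmbedding (n := n))) k := by
          have h2 := prefixCount.le_add (T := Finset.univ.map (Fin.valEmbedding (n := n))) hk
          rw [prefixCount.eq_card (map_val_subset _)] at h2
          simp only [Finset.card_map, Finset.card_univ, Fintype.card_fin] at h2
          omega
        -- As the word starts with 0, every nonempty prefix has slack one, which absorbs the removal
        -- of any single player.
        have h5 : prefixCount T k ≤ k - 1 := by
          rcases Nat.eq_zero_or_pos k with rfl | hk
          · simp
          · have h7 := prefixCount.le_add (T := T) (show 1 ≤ k from hk)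
            have h8 : prefixCount T 1 = 0 := by
              have := prefixCount.succ_of_notMem h0
              simpa using this
            omega
        rw [Finset.map_erase, Fin.valEmbedding_apply]
        split_ifs at h3 <;> omega
      exact absurd (hv _ hmem) (by simp)
    · intro hnull
      have hmin : ∀ S ∈ (prefixGame n T hT).winning, S.card = T.card →
          (prefixGame n T hT).IsMinimalWinning S := by
        refine fun S hS hc => ⟨hS, fun S' hS' hw => ?_⟩
        have h2 := hw n le_rfl
        rw [prefixCount.eq_card hTn, prefixCount.eq_card (map_val_subset _), Finset.card_map] at h2
        have := Finset.card_lt_card hS'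
        omega
      have hcard : (finCoalition n T).card = T.card := by
        rw [← Finset.card_map Fin.valEmbedding, map_finCoalition hTn]
      have hself := self_mem_winning (hT := hT) hTn
      by_cases hi : i ∈ finCoalition n T
      · exact hnull _ (hmin _ hself hcard) hi
      · have hlast : (⟨n - 1, by omega⟩ : Fin n) ∈ finCoalition n T := by
          simp [finCoalition, h1]
        refine hnull (insert i ((finCoalition n T).erase ⟨n - 1, by omega⟩)) (hmin _ ?_ ?_)
          (Finset.mem_insert_self _ _)
        · have hd := desirable_of_le (hT := hT)
            (show i ≤ ⟨n - 1, by omega⟩ from Nat.le_sub_one_of_lt i.isLt)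
          exact (desirable_iff _ _ _).1 hd _ hself hlast hi
        · rw [Finset.card_insert_of_notMem (by simp [hi]), Finset.card_erase_of_mem hlast, hcard]
          have : 0 < T.card := Finset.card_pos.2 ⟨_, h1⟩
          omega

end prefixGame

/-! ### Reduction of weighted games to binary words -/

namespace SimpleGame

/-- Nonnegative decreasing weights are monotone with respect to dominance of prefixes. -/
theorem sum_le_sum_of_prefixCount_le {n : ℕ} {w : Fin n → ℝ} (hw : ∀ i, 0 ≤ w i)
    (hanti : Antitone w) {S T : Finset (Fin n)}
    (h : ∀ k ≤ n, prefixCount (T.map Fin.valEmbedding) k ≤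
      prefixCount (S.map Fin.valEmbedding) k) :
    ∑ i ∈ T, w i ≤ ∑ i ∈ S, w i := by
  set v : ℕ → ℝ := fun a => if h : a < n then w ⟨a, h⟩ else 0 with hv
  have hv0 : ∀ a, 0 ≤ v a := by
    intro a
    simp only [hv]
    split_ifs
    · exact hw _
    · exact le_rfl
  have hvs : ∀ a, v (a + 1) ≤ v a := by
    intro a
    by_cases ha : a + 1 < n
    · simp only [hv, ha, dif_pos, show a < n by omega]
      exact hanti (Nat.le_succ a)
    · rw [show v (a + 1) = 0 by simp [hv, ha]]
      exact hv0 a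
  have hsum : ∀ X : Finset (Fin n), ∑ i ∈ X, w i =
      ∑ a ∈ Finset.range n, if a ∈ X.map Fin.valEmbedding then v a else 0 := by
    intro X
    rw [Finset.sum_ite_mem, Finset.inter_eq_right.2 (map_val_subset X), Finset.sum_map]
    refine Finset.sum_congr rfl fun i _ => ?_
    simp [hv]
  rw [hsum, hsum]
  set A := T.map Fin.valEmbedding
  set B := S.map Fin.valEmbedding
  -- Abel summation: the boundary term carries the current surplus of `B` over `A`, valued at the
  -- next and hence no larger weight.
  have key : ∀ m ≤ n, (∑ a ∈ Finset.range m, if a ∈ A then v a else 0) +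
      ((prefixCount B m : ℝ) - prefixCount A m) * v m ≤
        ∑ a ∈ Finset.range m, if a ∈ B then v a else 0 := by
    intro m
    induction m with
    | zero => simp
    | succ m ih =>
      intro hm
      have ih := ih (by omega)
      have h1 : (prefixCount A (m + 1) : ℝ) ≤ prefixCount B (m + 1) := by
        exact_mod_cast h (m + 1) hm
      have h2 := mul_le_mul_of_nonneg_left (hvs m) (sub_nonneg.2 h1)
      have hpA : (prefixCount A (m + 1) : ℝ) = prefixCount A m + if m ∈ A then 1 else 0 := by
        rw [prefixCount.succ]; push_cast; rfl
      have hpB : (prefixCount B (m + 1) : ℝ) = prefixCount B m + if m ∈ B then 1 else 0 := by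
        rw [prefixCount.succ]; push_cast; rfl
      rw [Finset.sum_range_succ, Finset.sum_range_succ]
      refine le_trans (add_le_add_right h2 _) ?_
      rw [hpA, hpB]
      by_cases hA : m ∈ A <;> by_cases hB : m ∈ B <;> simp only [hA, hB, if_true, if_false] <;>
        linarith
  have h1 := key n le_rfl
  have h2 : (prefixCount A n : ℝ) ≤ prefixCount B n := by exact_mod_cast h n le_rfl
  have h3 := mul_nonneg (sub_nonneg.2 h2) (hv0 n)
  linarith

/-- If the players are sorted by desirability, some least winning coalition consists of the last
players within each class. -/
theorem exists_least_winning_last {n : ℕ} {G : SimpleGame (Fin n)}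
    (h : ∃ S₀ ∈ G.winning, ∀ S ∈ G.winning, G.Dominates S S₀) :
    ∃ S₀ ∈ G.winning, (∀ S ∈ G.winning, G.Dominates S S₀) ∧
      ∀ i j, i < j → G.Desirable i j → G.Desirable j i → i ∈ S₀ → j ∈ S₀ := by
  classical
  set X : Finset (Finset (Fin n)) :=
    Finset.univ.filter fun S₀ => S₀ ∈ G.winning ∧ ∀ S ∈ G.winning, G.Dominates S S₀ with hX
  have hne : X.Nonempty := by
    obtain ⟨S₀, h1, h2⟩ := h
    exact ⟨S₀, by simp only [hX, Finset.mem_filter, Finset.mem_univ, true_and]; exact ⟨h1, h2⟩⟩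
  -- Maximising the sum of the indices pushes the members to the end of each class, since an
  -- exchange inside a class preserves leastness.
  obtain ⟨S₀, hS₀, hmax⟩ := X.exists_max_image (fun S => ∑ i ∈ S, i.val) hne
  have hmem : ∀ S₀, S₀ ∈ X ↔ S₀ ∈ G.winning ∧ ∀ S ∈ G.winning, G.Dominates S S₀ := by
    intro S₀; simp [hX]
  rw [hmem] at hS₀
  refine ⟨S₀, hS₀.1, hS₀.2, fun i j hij hd hd' hi => ?_⟩
  by_contra hj
  have hlt : i.val < j.val := hij
  have hj' : j ∉ S₀.erase i := fun h => hj (Finset.mem_of_mem_erase h)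
  have hS₁ : insert j (S₀.erase i) ∈ X := by
    rw [hmem]
    refine ⟨(desirable_iff _ _ _).1 hd' S₀ hS₀.1 hi hj, fun S hS => (hS₀.2 S hS).trans ?_⟩
    intro k
    by_cases hjk : j ∈ G.upperSet k
    · have hik : i ∈ G.upperSet k := by
        rw [mem_upperSet] at *; exact G.desirable_trans hd hjk
      have hsub : insert j (S₀.erase i) ∩ G.upperSet k ⊆
          insert j ((S₀ ∩ G.upperSet k).erase i) := by
        intro x hx
        simp only [Finset.mem_inter, Finset.mem_insert, Finset.mem_erase] at *
        tauto
      refine (Finset.card_le_card hsub).trans ((Finset.card_insert_le _ _).trans ?_)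
      have hmem : i ∈ S₀ ∩ G.upperSet k := Finset.mem_inter.2 ⟨hi, hik⟩
      rw [Finset.card_erase_of_mem hmem]
      have := Finset.card_pos.2 ⟨i, hmem⟩
      omega
    · refine Finset.card_le_card fun x hx => ?_
      simp only [Finset.mem_inter, Finset.mem_insert, Finset.mem_erase] at *
      rcases hx with ⟨rfl | hx, hx'⟩
      · exact absurd hx' hjk
      · exact ⟨hx.2, hx'⟩
  have := hmax _ hS₁
  rw [Finset.sum_insert hj'] at this
  have h3 := Finset.add_sum_erase S₀ (fun i : Fin n => i.val) hi
  omega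

/-- A game whose players are sorted by decreasing weights and that has one shift-minimal winning
vector is a prefix game. -/
theorem exists_winning_eq_prefixGame {n : ℕ} {G : SimpleGame (Fin n)} {w : Fin n → ℝ} {q : ℝ}
    (hw : ∀ i, 0 ≤ w i) (hanti : Antitone w) (hq : 0 < q)
    (h : ∀ S, S ∈ G.winning ↔ q ≤ ∑ i ∈ S, w i) (h1 : G.numShiftMinimal = 1) :
    ∃ T ⊆ Finset.range n, ∃ hT : 0 < prefixCount T n,
      ∀ S, S ∈ G.winning ↔ S ∈ (prefixGame n T hT).winning := by
  classical
  have hG : G.IsComplete := IsWeighted.isComplete ⟨w, q, hw, hq, h⟩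
  have hdes : ∀ i j, i ≤ j → G.Desirable i j := by
    intro i j hij
    rw [desirable_iff]
    intro S hS hj hi
    rw [h] at hS ⊢
    rw [Finset.sum_insert (by simp [hi])]
    have := Finset.add_sum_erase S w hj
    have := hanti hij
    linarith
  obtain ⟨S₀, hS₀, hmin, hlast⟩ :=
    exists_least_winning_last (hG.numShiftMinimal_eq_one_iff.1 h1)
  have hne : S₀.Nonempty := by
    rw [Finset.nonempty_iff_ne_empty]
    rintro rfl
    exact G.empty_notMem hS₀
  refine ⟨S₀.map Fin.valEmbedding, map_val_subset _,
    prefixCount.pos (by simpa using hne) (map_val_subset _), fun S => ⟨fun hS k hk => ?_, ?_⟩⟩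
  · rcases Nat.eq_zero_or_pos k with rfl | hkpos
    · simp
    have hpc : ∀ X : Finset (Fin n), prefixCount (X.map Fin.valEmbedding) k =
        (X ∩ Finset.univ.filter fun i : Fin n => i.val < k).card := by
      intro X
      rw [prefixCount.eq_card_filter, Finset.filter_map, Finset.card_map]
      congr 1
      ext i
      simp
    rw [hpc, hpc]
    set K := Finset.univ.filter fun i : Fin n => i.val < k with hK
    set j : Fin n := ⟨k - 1, by omega⟩ with hj
    have hKU : K ⊆ G.upperSet j := by
      intro i hi
      rw [mem_upperSet]
      have : i.val < k := by simpa [hK] using hi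
      exact hdes _ _ (Nat.le_sub_one_of_lt this)
    -- The prefix `K` may end inside the class of `j`. If `S₀` contains the whole rest of that
    -- class, subtracting it from the inequality for the upper set gives the one for `K`.
    by_cases hall : G.upperSet j \ K ⊆ S₀
    · have e1 : (S₀ ∩ G.upperSet j).card = (S₀ ∩ K).card + (G.upperSet j \ K).card := by
        rw [← Finset.card_union_of_disjoint]
        · congr 1
          ext i
          have h1 := @hKU i
          have h2 := @hall i
          simp only [Finset.mem_inter, Finset.mem_union, Finset.mem_sdiff] at *
          tauto
        · rw [Finset.disjoint_left]
          intro i hi hi'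
          simp only [Finset.mem_inter, Finset.mem_sdiff] at *
          tauto
      have e2 : (S ∩ G.upperSet j).card ≤ (S ∩ K).card + (G.upperSet j \ K).card := by
        refine le_trans (Finset.card_le_card ?_) (Finset.card_union_le _ _)
        intro i
        simp only [Finset.mem_inter, Finset.mem_union, Finset.mem_sdiff]
        tauto
      have := hmin S hS j
      omega
    · obtain ⟨x, hx, hxS⟩ := Finset.not_subset.1 hall
      rw [Finset.mem_sdiff, mem_upperSet] at hx
      have hxk : k ≤ x.val := by
        by_contra hlt
        exact hx.2 (by simp [hK]; omega)
      set V := Finset.univ.filter fun i => ¬ G.Desirable j i with hV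
      have hVK : V ⊆ K := by
        intro i hi
        simp only [hV, hK, Finset.mem_filter, Finset.mem_univ, true_and] at *
        by_contra hlt
        exact hi (hdes _ _ (show k - 1 ≤ i.val by omega))
      have hSV : S₀ ∩ K ⊆ S₀ ∩ V := by
        intro i hi
        simp only [hV, hK, Finset.mem_inter, Finset.mem_filter, Finset.mem_univ, true_and] at *
        refine ⟨hi.1, fun hji => hxS (hlast i x (show i.val < x.val by omega)
          (hdes _ _ (show i.val ≤ x.val by omega)) (G.desirable_trans hx.1 hji) hi.1)⟩
      refine (Finset.card_le_card hSV).trans (le_trans ?_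
        (Finset.card_le_card (Finset.inter_subset_inter_left hVK)))
      rcases hG.exists_upperSet_eq j with hv | ⟨v, hv⟩
      · rw [hV, hv]; simp
      · rw [hV, hv]; exact hmin S hS v
  · intro hS
    rw [h] at hS₀ ⊢
    exact hS₀.trans (sum_le_sum_of_prefixCount_le hw hanti hS)

/-- Every weighted game with one shift-minimal winning vector is isomorphic to a prefix game. -/
theorem IsWeighted.exists_isomorphic_prefixGame {n : ℕ} {G : SimpleGame (Fin n)}
    (hG : G.IsWeighted) (h1 : G.numShiftMinimal = 1) :
    ∃ T ⊆ Finset.range n, ∃ hT : 0 < prefixCount T n, (prefixGame n T hT).Isomorphic G := by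
  obtain ⟨w, q, hw, hq, h⟩ := hG
  set σ := Tuple.sort fun i => -w i with hσ
  have hmono : Monotone ((fun i => -w i) ∘ σ) := Tuple.monotone_sort _
  let G' : SimpleGame (Fin n) :=
    { winning := {S | S.map σ.toEmbedding ∈ G.winning}
      empty_notMem := by simpa using G.empty_notMem
      univ_mem := by simpa using G.univ_mem
      mono := fun S T hS hST => G.mono _ _ hS (Finset.map_subset_map.2 hST) }
  have hiso : G'.Isomorphic G := ⟨σ, fun S => Iff.rfl⟩
  have hG' : ∀ S, S ∈ G'.winning ↔ q ≤ ∑ i ∈ S, (w ∘ σ) i := by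
    intro S
    have := h (S.map σ.toEmbedding)
    rw [Finset.sum_map] at this
    exact this
  obtain ⟨T, hTn, hT, hTG⟩ := exists_winning_eq_prefixGame (G := G') (w := w ∘ σ)
    (fun i => hw _) (fun i j hij => neg_le_neg_iff.1 (hmono hij)) hq hG'
    (hiso.symm.numShiftMinimal_eq_one ⟨w, q, hw, hq, h⟩ h1)
  exact ⟨T, hTn, hT, σ, fun S => (hTG S).symm⟩

end SimpleGame

/-! ### Which words give weighted games -/

open SimpleGame

/-- The weights `u₀ [i < k₀] + u₁ [i < k₁] + u₂ [i < k₂]`, summed over a coalition. -/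
theorem sum_stepWeights {n : ℕ} (S : Finset (Fin n)) (k₀ k₁ k₂ u₀ u₁ u₂ : ℕ) :
    ∑ i ∈ S, (((if i.val < k₀ then u₀ else 0) + (if i.val < k₁ then u₁ else 0) +
      (if i.val < k₂ then u₂ else 0) : ℕ) : ℝ) =
      ((u₀ * prefixCount (S.map Fin.valEmbedding) k₀ +
        u₁ * prefixCount (S.map Fin.valEmbedding) k₁ +
        u₂ * prefixCount (S.map Fin.valEmbedding) k₂ : ℕ) : ℝ) := by
  have key : ∀ k u : ℕ, ∑ i ∈ S, (if i.val < k then u else 0) =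
      u * prefixCount (S.map Fin.valEmbedding) k := by
    intro k u
    rw [← Finset.sum_filter, Finset.sum_const, prefixCount.eq_card_filter, Finset.filter_map,
      Finset.card_map, smul_eq_mul, mul_comm]
    rfl
  rw [← Nat.cast_sum, Finset.sum_add_distrib, Finset.sum_add_distrib, key, key, key]

theorem isWeighted_of_stepWeights {n : ℕ} {G : SimpleGame (Fin n)} (k₀ k₁ k₂ u₀ u₁ u₂ q : ℕ)
    (hq : 0 < q) (h : ∀ S, S ∈ G.winning ↔
      q ≤ u₀ * prefixCount (S.map Fin.valEmbedding) k₀ +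
        u₁ * prefixCount (S.map Fin.valEmbedding) k₁ +
        u₂ * prefixCount (S.map Fin.valEmbedding) k₂) : G.IsWeighted := by
  refine ⟨fun i => (((if i.val < k₀ then u₀ else 0) + (if i.val < k₁ then u₁ else 0) +
      (if i.val < k₂ then u₂ else 0) : ℕ) : ℝ), q, fun i => Nat.cast_nonneg _,
      Nat.cast_pos.2 hq, fun S => ?_⟩
  rw [sum_stepWeights, h, Nat.cast_le]

/-- The prefix counts of the word `1ᵖ 0ᵃ 1ᵇ 0ᶜ 1ᵈ 0ᵉ`. -/
def blockCount (p a b c d j : ℕ) : ℕ :=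
  min j p + min (j - (p + a)) b + min (j - (p + a + b + c)) d

namespace prefixGame

variable {n : ℕ} {T : Finset ℕ} {hT : 0 < prefixCount T n}

/-- The prefix inequalities at the ends of the blocks of ones imply the others: the count of `T` is
constant on blocks of zeros and increases with slope one, the largest possible, on blocks of ones.
-/
theorem mem_winning_of_blockCount {p a b c d e : ℕ} (hn : n = p + a + b + c + d + e)
    (h : ∀ j ≤ n, prefixCount T j = blockCount p a b c d j) {S : Finset (Fin n)} :
    S ∈ (prefixGame n T hT).winning ↔
      p ≤ prefixCount (S.map Fin.valEmbedding) p ∧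
      p + b ≤ prefixCount (S.map Fin.valEmbedding) (p + a + b) ∧
      p + b + d ≤ prefixCount (S.map Fin.valEmbedding) (p + a + b + c + d) := by
  rw [mem_winning]
  constructor
  · intro hS
    have h0 := hS p (by omega)
    have h1 := hS (p + a + b) (by omega)
    have h2 := hS (p + a + b + c + d) (by omega)
    rw [h _ (by omega), blockCount] at h0 h1 h2
    omega
  · rintro ⟨h0, h1, h2⟩ k hk
    rw [h k hk, blockCount]
    set U := S.map Fin.valEmbedding
    have key : ∀ l, (k ≤ l → prefixCount U l ≤ prefixCount U k + (l - k)) ∧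
        (l ≤ k → prefixCount U l ≤ prefixCount U k) :=
      fun l => ⟨prefixCount.le_add, prefixCount.mono⟩
    have k0 := key p
    have k1 := key (p + a + b)
    have k2 := key (p + a + b + c + d)
    omega

/-- The three inequalities merge into one. The first gets a coefficient so large that failing it
cannot be compensated; the other two need coefficients `u₁`, `u₂` under which a surplus in one never
outweighs a deficit in the other. -/
theorem isWeighted_of_blockCount {p a b c d e : ℕ} (hn : n = p + a + b + c + d + e)
    (h : ∀ j ≤ n, prefixCount T j = blockCount p a b c d j) (hcd : c ≤ 1 ∨ d ≤ 1) :
    (prefixGame n T hT).IsWeighted := by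
  have hpos : 0 < p + b + d := by
    have := hT
    rw [h n le_rfl, blockCount] at this
    omega
  obtain ⟨u₁, u₂, hu₂, hu⟩ : ∃ u₁ u₂ : ℕ, 0 < u₂ ∧ ∀ x y, x ≤ y → x ≤ p + a + b →
      y ≤ x + (c + d) → u₁ * (p + b) + u₂ * (p + b + d) ≤ u₁ * x + u₂ * y →
        p + b ≤ x ∧ p + b + d ≤ y := by
    rcases hcd with hc | hd
    -- For c ≤ 1: the surplus of `x` is at most `a`, too little to offset `a + 1`; and if `x` falls
    -- short, `y ≤ x + c + d` leaves `y` no surplus.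
    · refine ⟨1, a + 1, by omega, fun x y hxy hx hy hle => ?_⟩
      have h2 : p + b + d ≤ y := by
        by_contra hlt
        have : (a + 1) * (y + 1) ≤ (a + 1) * (p + b + d) := Nat.mul_le_mul_left _ (by omega)
        rw [mul_add] at this
        omega
      refine ⟨?_, h2⟩
      by_contra hlt
      have : (a + 1) * y ≤ (a + 1) * (p + b + d) := Nat.mul_le_mul_left _ (by omega)
      omega
    -- For d ≤ 1: a deficit in `x` costs at least `c`, while the surplus of `y` is then less than
    -- `c`; and if `y` falls short, `x ≤ y` leaves `x` no surplus.
    · refine ⟨c, 1, by omega, fun x y hxy hx hy hle => ?_⟩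
      have h1 : p + b ≤ x := by
        by_contra hlt
        have : c * (x + 1) ≤ c * (p + b) := Nat.mul_le_mul_left _ (by omega)
        rw [mul_add] at this
        omega
      refine ⟨h1, ?_⟩
      by_contra hlt
      have : x = p + b := by omega
      subst this
      omega
  refine isWeighted_of_stepWeights p (p + a + b) (p + a + b + c + d)
    (u₁ * (p + a + b) + u₂ * (p + a + b + c + d) + 1) u₁ u₂
    ((u₁ * (p + a + b) + u₂ * (p + a + b + c + d) + 1) * p + u₁ * (p + b) + u₂ * (p + b + d))
    ?_ fun S => ?_
  · have := Nat.mul_pos hu₂ hpos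
    omega
  rw [mem_winning_of_blockCount hn h]
  set U := S.map Fin.valEmbedding
  set W := u₁ * (p + a + b) + u₂ * (p + a + b + c + d) + 1 with hW
  constructor
  · rintro ⟨h0, h1, h2⟩
    gcongr
  · intro hle
    have l0 := prefixCount.le_self (T := U) (k := p)
    have l1 := prefixCount.le_self (T := U) (k := p + a + b)
    have l2 := prefixCount.le_self (T := U) (k := p + a + b + c + d)
    have m1 := Nat.mul_le_mul_left u₁ l1
    have m2 := Nat.mul_le_mul_left u₂ l2
    have h0 : p ≤ prefixCount U p := by
      by_contra hlt
      have : W * (prefixCount U p + 1) ≤ W * p := Nat.mul_le_mul_left _ (by omega)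
      rw [mul_add] at this
      omega
    refine ⟨h0, hu _ _ (prefixCount.mono (by omega)) l1 ?_ ?_⟩
    · have := prefixCount.le_add (T := U) (show p + a + b ≤ p + a + b + c + d by omega)
      omega
    · rw [show prefixCount U p = p by omega] at hle
      omega

theorem sum_finCoalition {w : Fin n → ℝ} {v : ℕ → ℝ} (hv : ∀ i : Fin n, v i = w i)
    {U : Finset ℕ} (hU : U ⊆ Finset.range n) : ∑ i ∈ finCoalition n U, w i = ∑ a ∈ U, v a := by
  conv_rhs => rw [← map_finCoalition hU]
  rw [Finset.sum_map]
  exact Finset.sum_congr rfl fun i _ => (hv i).symm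

/-- A trade of two winning against two losing coalitions. -/
theorem not_isWeighted_of_trade (hTn : T ⊆ Finset.range n) {x y z s v u : ℕ}
    (hx : x ∉ T) (hy : y ∈ T) (hz : z ∉ T) (hs : s ∉ T) (hv : v ∈ T) (hu : u ∈ T)
    (hxy : x < y) (hyz : y < z) (hys : y < s) (hzs : z ≠ s) (hvu : v ≠ u) (hzv : z < v)
    (hsu : s < u) : ¬ (prefixGame n T hT).IsWeighted := by
  rintro ⟨w, q, -, -, h⟩
  have hlt : ∀ a ∈ T, a < n := fun a ha => Finset.mem_range.1 (hTn ha)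
  have hun := hlt u hu
  have hvn := hlt v hv
  set g : ℕ → ℝ := fun a => if h : a < n then w ⟨a, h⟩ else 0 with hg
  have hgw : ∀ i : Fin n, g i = w i := by intro i; simp [hg]
  have hins : ∀ {a : ℕ} {U : Finset ℕ}, a < n → U ⊆ Finset.range n →
      insert a U ⊆ Finset.range n := fun ha hU =>
    Finset.insert_subset (Finset.mem_range.2 ha) hU
  have hwin : ∀ U ⊆ Finset.range n, (∀ k ≤ n, prefixCount T k ≤ prefixCount U k) ↔
      q ≤ ∑ a ∈ U, g a := by
    intro U hU
    rw [← sum_finCoalition hgw hU, ← h, finCoalition_mem_winning hU]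
  have hxn : x < n := by omega
  have hzn : z < n := by omega
  have hsn : s < n := by omega
  have hEn : T.erase y ⊆ Finset.range n := (Finset.erase_subset _ _).trans hTn
  have hFn : (T.erase v).erase u ⊆ Finset.range n :=
    (Finset.erase_subset _ _).trans ((Finset.erase_subset _ _).trans hTn)
  have huv : u ∈ T.erase v := Finset.mem_erase.2 ⟨hvu.symm, hu⟩
  have hxE : x ∉ T.erase y := fun h => hx (Finset.mem_of_mem_erase h)
  have hzE : z ∉ T.erase y := fun h => hz (Finset.mem_of_mem_erase h)
  have hsE : s ∉ insert z (T.erase y) := by simp [hzs.symm, hs]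
  have hxF : x ∉ (T.erase v).erase u := by simp [hx]
  have hzF : z ∉ (T.erase v).erase u := by simp [hz]
  have hsF : s ∉ insert z ((T.erase v).erase u) := by simp [hzs.symm, hs]
  -- The four coalitions are X = T − y + x, Y = T − v − u + z + s, A = T − y + z + s and B = T − v −
  -- u + x. The pairs X, Y and A, B use every player equally often; X and Y win by shifting members
  -- to stronger positions.
  have hX := hwin _ (hins hxn hEn)
  have hY := hwin _ (hins hsn (hins hzn hFn))
  have hA := hwin _ (hins hsn (hins hzn hEn))
  have hB := hwin _ (hins hxn hFn)
  have sE := Finset.add_sum_erase T g hy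
  have sF₁ := Finset.add_sum_erase T g hv
  have sF₂ := Finset.add_sum_erase (T.erase v) g huv
  have cE := fun k => prefixCount.erase (k := k) hy
  have cF₁ := fun k => prefixCount.erase (k := k) hv
  have cF₂ := fun k => prefixCount.erase (k := k) huv
  have cX := fun k => prefixCount.insert (k := k) hxE
  have cA₁ := fun k => prefixCount.insert (k := k) hzE
  have cA₂ := fun k => prefixCount.insert (k := k) hsE
  have cB := fun k => prefixCount.insert (k := k) hxF
  have cY₁ := fun k => prefixCount.insert (k := k) hzF
  have cY₂ := fun k => prefixCount.insert (k := k) hsF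
  have hanti : ∀ {a b : ℕ} (k : ℕ), a < b →
      (if b < k then 1 else 0) ≤ if a < k then 1 else 0 := by
    intro a b k hab
    split_ifs <;> omega
  have wX := hX.1 fun k _ => by
    have := cE k; have := cX k; have := hanti k hxy
    omega
  have wY := hY.1 fun k _ => by
    have := cF₁ k; have := cF₂ k; have := cY₁ k; have := cY₂ k
    have := hanti k hzv; have := hanti k hsu
    omega
  -- `A` loses because it is one short in the prefix ending at `y`; `B` loses because it has one
  -- member fewer than `T`.
  have lA := mt hA.2 fun hA => by
    have := cE (y + 1); have := cA₁ (y + 1); have := cA₂ (y + 1)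
    have := hA (y + 1) (by omega)
    simp only [show y < y + 1 by omega, show ¬ z < y + 1 by omega, show ¬ s < y + 1 by omega,
      if_true, if_false] at *
    omega
  have lB := mt hB.2 fun hB => by
    have := cF₁ n; have := cF₂ n; have := cB n
    have := hB n le_rfl
    simp only [hxn, hun, hvn, if_true] at *
    omega
  rw [Finset.sum_insert hxE] at wX
  rw [Finset.sum_insert hsF, Finset.sum_insert hzF] at wY
  rw [Finset.sum_insert hsE, Finset.sum_insert hzE] at lA
  rw [Finset.sum_insert hxF] at lB
  linarith

end prefixGame

/-! ### An automaton for the words of weighted games -/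

/-- The states of the automaton that reads the indicator word of `T`: after the leading ones
(`lead`) come `zero`, `one`, a gap of length one (`gap`) or more (`wideGap`), then the final ones
(`tail`, `longTail` after a gap of length one, `wideTail` after a wide gap) and zeros (`nulls`). -/
inductive Phase
  | lead | zero | one | gap | wideGap | tail | longTail | wideTail | nulls | bad
  deriving DecidableEq

namespace Phase

/-- The transitions of the automaton. -/
def step : Phase → Bool → Phase
  | lead, true => lead
  | lead, false => zero
  | zero, true => one
  | zero, false => zero
  | one, true => one
  | one, false => gap
  | gap, true => tail
  | gap, false => wideGap
  | wideGap, true => wideTail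
  | wideGap, false => wideGap
  | tail, true => longTail
  | tail, false => nulls
  | longTail, true => longTail
  | longTail, false => nulls
  | wideTail, true => bad
  | wideTail, false => nulls
  | nulls, true => bad
  | nulls, false => nulls
  | bad, _ => bad

/-- The phase after reading the first `k` letters. -/
def run (T : Finset ℕ) : ℕ → Phase
  | 0 => lead
  | k + 1 => (run T k).step (decide (k ∈ T))

/-- The last letter read in a phase. -/
def lastLetter : Phase → Bool
  | lead | one | tail | longTail | wideTail => true
  | _ => false

/-- The number of descents in a phase, after a first letter that is a one or not. -/
def numDescents (v : Bool) : Phase → ℕ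
  | lead => 0
  | zero | one => if v then 1 else 0
  | gap | wideGap | tail | longTail | wideTail => 1 + if v then 1 else 0
  | nulls => 2 + if v then 1 else 0
  | bad => 0

variable {T : Finset ℕ} {k : ℕ}

theorem run_congr {U : Finset ℕ} (h : ∀ a < k, a ∈ T ↔ a ∈ U) : run T k = run U k := by
  induction k with
  | zero => rfl
  | succ k ih =>
    rw [run, run, ih fun a ha => h a (by omega)]
    congr 1
    exact decide_eq_decide.2 (h k (by omega))

theorem run_succ_of_mem (h : k ∈ T) : run T (k + 1) = (run T k).step true := by
  simp [run, h]

theorem run_succ_of_notMem (h : k ∉ T) : run T (k + 1) = (run T k).step false := by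
  simp [run, h]

/-- The block lengths possible in each phase. -/
def BlockCondition (a b c d e : ℕ) : Phase → Prop
  | lead => a = 0 ∧ b = 0 ∧ c = 0 ∧ d = 0 ∧ e = 0
  | zero => b = 0 ∧ c = 0 ∧ d = 0 ∧ e = 0
  | one => c = 0 ∧ d = 0 ∧ e = 0
  | gap => c = 1 ∧ d = 0 ∧ e = 0
  | wideGap => d = 0 ∧ e = 0
  | tail => c = 1 ∧ d = 1 ∧ e = 0
  | longTail => c = 1 ∧ e = 0
  | wideTail => d = 1 ∧ e = 0
  | nulls => c = 1 ∨ d = 1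
  | bad => True

/-- Reading one more letter lengthens exactly one of the six blocks. Blocks may be empty, so a short
word fits the same pattern. -/
theorem exists_blockCount (T : Finset ℕ) (k : ℕ) (h : run T k ≠ bad) :
    ∃ p a b c d e, k = p + a + b + c + d + e ∧ BlockCondition a b c d e (run T k) ∧
      ∀ j ≤ k, prefixCount T j = blockCount p a b c d j := by
  induction k with
  | zero =>
    refine ⟨0, 0, 0, 0, 0, 0, rfl, by simp [run, BlockCondition], fun j hj => ?_⟩
    obtain rfl : j = 0 := by omega
    simp [blockCount]
  | succ k ih =>
    have hne : run T k ≠ bad := by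
      intro hb
      rw [run, hb] at h
      exact h rfl
    obtain ⟨p, a, b, c, d, e, hk, hc, hcount⟩ := ih hne
    have extend : ∀ p' a' b' c' d' e' : ℕ, k + 1 = p' + a' + b' + c' + d' + e' →
        BlockCondition a' b' c' d' e' (run T (k + 1)) →
        (∀ j ≤ k, blockCount p a b c d j = blockCount p' a' b' c' d' j) →
        (blockCount p a b c d k + if k ∈ T then 1 else 0) = blockCount p' a' b' c' d' (k + 1) →
        ∃ p a b c d e, k + 1 = p + a + b + c + d + e ∧
          BlockCondition a b c d e (run T (k + 1)) ∧
          ∀ j ≤ k + 1, prefixCount T j = blockCount p a b c d j := by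
      intro p' a' b' c' d' e' h1 h2 h3 h4
      refine ⟨p', a', b', c', d', e', h1, h2, fun j hj => ?_⟩
      rcases Nat.lt_or_ge j (k + 1) with hlt | hge
      · rw [hcount j (by omega), h3 j (by omega)]
      · obtain rfl : j = k + 1 := by omega
        rw [prefixCount.succ, hcount k le_rfl, h4]
    by_cases hmem : k ∈ T
    · rw [run_succ_of_mem hmem] at *
      simp only [hmem, if_true] at extend
      generalize run T k = ph at *
      unfold blockCount at extend
      cases ph <;> simp only [step, BlockCondition, ne_eq, not_true_eq_false] at *
      · apply extend (p + 1) a b c d e <;> intros <;> omega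
      · apply extend p a (b + 1) c d e <;> intros <;> omega
      · apply extend p a (b + 1) c d e <;> intros <;> omega
      · apply extend p a b c (d + 1) e <;> intros <;> omega
      · apply extend p a b c (d + 1) e <;> intros <;> omega
      · apply extend p a b c (d + 1) e <;> intros <;> omega
      · apply extend p a b c (d + 1) e <;> intros <;> omega
    · rw [run_succ_of_notMem hmem] at *
      simp only [hmem, if_false] at extend
      generalize run T k = ph at *
      unfold blockCount at extend
      cases ph <;> simp only [step, BlockCondition, ne_eq, not_true_eq_false] at *
      · apply extend p (a + 1) b c d e <;> intros <;> omega
      · apply extend p (a + 1) b c d e <;> intros <;> omega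
      · apply extend p a b (c + 1) d e <;> intros <;> omega
      · apply extend p a b (c + 1) d e <;> intros <;> omega
      · apply extend p a b (c + 1) d e <;> intros <;> omega
      · apply extend p a b c d (e + 1) <;> intros <;> omega
      · apply extend p a b c d (e + 1) <;> intros <;> omega
      · apply extend p a b c d (e + 1) <;> intros <;> omega
      · apply extend p a b c d (e + 1) <;> intros <;> omega

/-- The positions that witness a phase. -/
def Witness (T : Finset ℕ) (k : ℕ) : Phase → Prop
  | lead => True
  | zero => ∃ x < k, x ∉ T
  | one => ∃ x y, x < y ∧ y < k ∧ x ∉ T ∧ y ∈ T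
  | gap => ∃ x y z, x < y ∧ y < z ∧ z < k ∧ x ∉ T ∧ y ∈ T ∧ z ∉ T
  | wideGap => ∃ x y z s, x < y ∧ y < z ∧ z < s ∧ s < k ∧ x ∉ T ∧ y ∈ T ∧ z ∉ T ∧ s ∉ T
  | tail | longTail => ∃ x y z v, x < y ∧ y < z ∧ z < v ∧ v < k ∧
      x ∉ T ∧ y ∈ T ∧ z ∉ T ∧ v ∈ T
  | wideTail => ∃ x y z s v, x < y ∧ y < z ∧ z < s ∧ s < v ∧ v < k ∧
      x ∉ T ∧ y ∈ T ∧ z ∉ T ∧ s ∉ T ∧ v ∈ T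
  | nulls => ∃ x y z v s, x < y ∧ y < z ∧ z < v ∧ v < s ∧ s < k ∧
      x ∉ T ∧ y ∈ T ∧ z ∉ T ∧ v ∈ T ∧ s ∉ T
  | bad => ∃ x y z s v u, x < y ∧ y < z ∧ y < s ∧ z ≠ s ∧ v ≠ u ∧ z < v ∧ s < u ∧ u < k ∧
      x ∉ T ∧ y ∈ T ∧ z ∉ T ∧ s ∉ T ∧ v ∈ T ∧ u ∈ T

/-- Used at `bad` only, where it supplies the positions for the trade; the other phases are the
induction invariant. The two ways into `bad` are the subsequences 010011 and 010101, and both fit `z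
≠ s`, `z < v`, `s < u`. -/
theorem witness_run (T : Finset ℕ) (k : ℕ) : Witness T k (run T k) := by
  induction k with
  | zero => trivial
  | succ k ih =>
    by_cases hmem : k ∈ T
    · rw [run_succ_of_mem hmem]
      generalize run T k = ph at *
      cases ph <;> simp only [step, Witness] at *
      · obtain ⟨x, hx, h⟩ := ih
        exact ⟨x, k, hx, by omega, h, hmem⟩
      · obtain ⟨x, y, h1, h2, h⟩ := ih
        exact ⟨x, y, h1, by omega, h⟩
      · obtain ⟨x, y, z, h1, h2, h3, h4, h5, h6⟩ := ih
        exact ⟨x, y, z, k, h1, h2, h3, by omega, h4, h5, h6, hmem⟩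
      · obtain ⟨x, y, z, s, h1, h2, h3, h4, h5, h6, h7, h8⟩ := ih
        exact ⟨x, y, z, s, k, h1, h2, h3, h4, by omega, h5, h6, h7, h8, hmem⟩
      · obtain ⟨x, y, z, v, h1, h2, h3, h4, h⟩ := ih
        exact ⟨x, y, z, v, h1, h2, h3, by omega, h⟩
      · obtain ⟨x, y, z, v, h1, h2, h3, h4, h⟩ := ih
        exact ⟨x, y, z, v, h1, h2, h3, by omega, h⟩
      · obtain ⟨x, y, z, s, v, h1, h2, h3, h4, h5, h6, h7, h8, h9, h10⟩ := ih
        exact ⟨x, y, z, s, v, k, by omega, by omega, by omega, by omega, by omega, by omega,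
          by omega, by omega, h6, h7, h8, h9, h10, hmem⟩
      · obtain ⟨x, y, z, v, s, h1, h2, h3, h4, h5, h6, h7, h8, h9, h10⟩ := ih
        exact ⟨x, y, z, s, v, k, by omega, by omega, by omega, by omega, by omega, by omega,
          by omega, by omega, h6, h7, h8, h10, h9, hmem⟩
      · obtain ⟨x, y, z, s, v, u, h1, h2, h3, h4, h5, h6, h7, h8, h⟩ := ih
        exact ⟨x, y, z, s, v, u, h1, h2, h3, h4, h5, h6, h7, by omega, h⟩
    · rw [run_succ_of_notMem hmem]
      generalize run T k = ph at *
      cases ph <;> simp only [step, Witness] at *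
      · exact ⟨k, by omega, hmem⟩
      · obtain ⟨x, hx, h⟩ := ih
        exact ⟨x, by omega, h⟩
      · obtain ⟨x, y, h1, h2, h3, h4⟩ := ih
        exact ⟨x, y, k, h1, h2, by omega, h3, h4, hmem⟩
      · obtain ⟨x, y, z, h1, h2, h3, h4, h5, h6⟩ := ih
        exact ⟨x, y, z, k, h1, h2, h3, by omega, h4, h5, h6, hmem⟩
      · obtain ⟨x, y, z, s, h1, h2, h3, h4, h⟩ := ih
        exact ⟨x, y, z, s, h1, h2, h3, by omega, h⟩
      · obtain ⟨x, y, z, v, h1, h2, h3, h4, h5, h6, h7, h8⟩ := ih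
        exact ⟨x, y, z, v, k, h1, h2, h3, h4, by omega, h5, h6, h7, h8, hmem⟩
      · obtain ⟨x, y, z, v, h1, h2, h3, h4, h5, h6, h7, h8⟩ := ih
        exact ⟨x, y, z, v, k, h1, h2, h3, h4, by omega, h5, h6, h7, h8, hmem⟩
      · obtain ⟨x, y, z, s, v, h1, h2, h3, h4, h5, h6, h7, h8, h9, h10⟩ := ih
        exact ⟨x, y, z, v, k, by omega, by omega, by omega, h5, by omega, h6, h7, h8, h10, hmem⟩
      · obtain ⟨x, y, z, v, s, h1, h2, h3, h4, h5, h⟩ := ih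
        exact ⟨x, y, z, v, s, h1, h2, h3, h4, by omega, h⟩
      · obtain ⟨x, y, z, s, v, u, h1, h2, h3, h4, h5, h6, h7, h8, h⟩ := ih
        exact ⟨x, y, z, s, v, u, h1, h2, h3, h4, h5, h6, h7, by omega, h⟩

theorem zero_mem_of_run_eq_lead (h : run T (k + 1) = lead) : 0 ∈ T := by
  induction k with
  | zero =>
    by_contra h0
    simp [run, h0, step] at h
  | succ k ih =>
    apply ih
    rw [run] at h
    generalize run T (k + 1) = ph at *
    generalize decide (k + 1 ∈ T) = b at *
    cases ph <;> cases b <;> simp [step] at *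

/-- The phase alone does not tell whether the block of leading ones is empty, so the first letter is
a separate parameter: it contributes the descent after that block. -/
theorem lastLetter_and_descents (T : Finset ℕ) (k : ℕ) (h : run T (k + 1) ≠ bad) :
    (k ∈ T ↔ (run T (k + 1)).lastLetter) ∧
      descents T k = (run T (k + 1)).numDescents (decide (0 ∈ T)) := by
  induction k with
  | zero =>
    by_cases h0 : 0 ∈ T <;> simp [run, h0, step, lastLetter, numDescents, descents]
  | succ k ih =>
    have hne : run T (k + 1) ≠ bad := by
      intro hb
      rw [run, hb] at h
      exact h rfl
    obtain ⟨ih1, ih2⟩ := ih hne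
    rw [descents_succ, ih2]
    have hlead := zero_mem_of_run_eq_lead (T := T) (k := k)
    by_cases hmem : k + 1 ∈ T
    · rw [run_succ_of_mem hmem] at *
      generalize run T (k + 1) = ph at *
      cases ph <;> simp_all [step, lastLetter, numDescents]
    · rw [run_succ_of_notMem hmem] at *
      generalize run T (k + 1) = ph at *
      cases ph <;> simp_all [step, lastLetter, numDescents] <;> omega

/-- Identifies the words without a one, which define no game and are left out of the count. -/
theorem run_eq_zero_iff (T : Finset ℕ) (k : ℕ) :
    prefixCount T (k + 1) = 0 ↔ run T (k + 1) = zero ∧ 0 ∉ T := by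
  induction k with
  | zero => by_cases h0 : 0 ∈ T <;> simp [prefixCount.succ, run, h0, step]
  | succ k ih =>
    by_cases hmem : k + 1 ∈ T
    · rw [prefixCount.succ_of_mem hmem, run_succ_of_mem hmem]
      generalize run T (k + 1) = ph
      cases ph <;> simp [step]
    · rw [prefixCount.succ_of_notMem hmem, run_succ_of_notMem hmem, ih]
      have hlead := zero_mem_of_run_eq_lead (T := T) (k := k)
      generalize run T (k + 1) = ph at *
      cases ph <;> simp_all [step]

end Phase

theorem prefixGame.isWeighted_iff {n : ℕ} {T : Finset ℕ} {hT : 0 < prefixCount T n}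
    (hTn : T ⊆ Finset.range n) : (prefixGame n T hT).IsWeighted ↔ Phase.run T n ≠ Phase.bad := by
  constructor
  · intro h hbad
    have hw := Phase.witness_run T n
    rw [hbad] at hw
    obtain ⟨x, y, z, s, v, u, h1, h2, h3, h4, h5, h6, h7, -, h8, h9, h10, h11, h12, h13⟩ := hw
    exact not_isWeighted_of_trade hTn h8 h9 h10 h11 h12 h13 h1 h2 h3 h4 h5 h6 h7 h
  · intro h
    obtain ⟨p, a, b, c, d, e, h1, h2, h3⟩ := Phase.exists_blockCount T n h
    refine isWeighted_of_blockCount h1 h3 ?_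
    generalize Phase.run T n = ph at *
    cases ph <;> simp only [Phase.BlockCondition] at h2 <;> first | omega | exact absurd rfl h

/-! ### Counting words by their final phase -/

open SimpleGame

/-- The sum of `g` over the final phases of the subsets `T` of `range n` with `0 ∈ T` or not,
according to `v`. -/
def phaseSum (n : ℕ) (v : Bool) (g : Phase → ℚ) : ℚ :=
  ∑ T ∈ (Finset.range n).powerset with decide (0 ∈ T) = v, g (Phase.run T n)

namespace phaseSum

/-- The transfer matrix acting on the test function `g`. The bound on `n` ensures that the appended
letter is not the first one. -/
theorem succ (n : ℕ) (hn : 1 ≤ n) (v : Bool) (g : Phase → ℚ) :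
    phaseSum (n + 1) v g = phaseSum n v fun p => g (p.step false) + g (p.step true) := by
  unfold phaseSum
  rw [Finset.sum_filter, Finset.sum_filter, Finset.range_add_one,
    Finset.sum_powerset_insert Finset.notMem_range_self, ← Finset.sum_add_distrib]
  refine Finset.sum_congr rfl fun T hT => ?_
  have hnT : n ∉ T := fun h => Finset.notMem_range_self (Finset.mem_powerset.1 hT h)
  have h0 : (0 ∈ insert n T) = (0 ∈ T) := by
    rw [Finset.mem_insert, or_iff_right (by omega)]
  have hrun : Phase.run (insert n T) n = Phase.run T n :=
    Phase.run_congr fun a ha => by simp [ha.ne]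
  rw [Phase.run_succ_of_notMem hnT, Phase.run_succ_of_mem (Finset.mem_insert_self n T), hrun]
  simp only [h0]
  split_ifs <;> simp

theorem one_false (g : Phase → ℚ) : phaseSum 1 false g = g .zero := by
  have h : ((Finset.range 1).powerset.filter fun T => decide (0 ∈ T) = false) = {∅} := by decide
  rw [phaseSum, h, Finset.sum_singleton]
  rfl

theorem one_true (g : Phase → ℚ) : phaseSum 1 true g = g .lead := by
  have h : ((Finset.range 1).powerset.filter fun T => decide (0 ∈ T) = true) = {{0}} := by decide
  rw [phaseSum, h, Finset.sum_singleton]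
  rfl

theorem two_false (g : Phase → ℚ) : phaseSum 2 false g = g .zero + g .one := by
  rw [succ 1 le_rfl, one_false]; rfl

theorem two_true (g : Phase → ℚ) : phaseSum 2 true g = g .zero + g .lead := by
  rw [succ 1 le_rfl, one_true]; rfl

/-- The coefficient of each phase is the number of words of length `n` that begin with 0 and end
there. The words ending in `bad` are discarded by `hg`. The induction varies `g`, as each step
replaces it by its image under the transfer matrix. -/
theorem eq_false (n : ℕ) (hn : 3 ≤ n) (g : Phase → ℚ) (hg : g .bad = 0) :
    phaseSum n false g = g .zero + (n - 1) * g .one + (n - 2) * g .gap +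
      (n - 2) * (n - 3) / 2 * g .wideGap + (n - 3) * g .tail +
      (n - 3) * (n - 4) / 2 * (g .longTail + g .wideTail) +
      (n - 3) * (n - 4) * (2 * n - 7) / 6 * g .nulls := by
  induction n, hn using Nat.le_induction generalizing g with
  | base =>
    rw [succ 2 (by omega), two_false]
    norm_num [Phase.step]
    ring
  | succ n hn ih =>
    rw [succ n (by omega), ih _ (by simp [Phase.step, hg])]
    simp only [Phase.step, hg]
    push_cast
    ring

theorem eq_true (n : ℕ) (hn : 3 ≤ n) (g : Phase → ℚ) (hg : g .bad = 0) :
    phaseSum n true g = g .lead + (n - 1) * g .zero + (n - 1) * (n - 2) / 2 * g .one +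
      (n - 2) * (n - 3) / 2 * g .gap + (n - 2) * (n - 3) * (n - 4) / 6 * g .wideGap +
      (n - 3) * (n - 4) / 2 * g .tail +
      (n - 3) * (n - 4) * (n - 5) / 6 * (g .longTail + g .wideTail) +
      ((n : ℚ) ^ 4 - 16 * n ^ 3 + 95 * n ^ 2 - 248 * n + 240) / 12 * g .nulls := by
  induction n, hn using Nat.le_induction generalizing g with
  | base =>
    rw [succ 2 (by omega), two_true]
    norm_num [Phase.step]
    ring
  | succ n hn ih =>
    rw [succ n (by omega), ih _ (by simp [Phase.step, hg])]
    simp only [Phase.step, hg]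
    push_cast
    ring

end phaseSum

/-! ### From isomorphism classes to words, and the final formulas -/

/-- The isomorphism classes of weighted games with one shift-minimal winning vector and an
invariant property correspond to subsets of `range n`. -/
theorem ncard_image_mk_eq {n : ℕ} {Q : SimpleGame (Fin n) → Prop}
    (hQ : ∀ G G', Isomorphic G G' → Q G → Q G') {P : Finset ℕ → Prop} [DecidablePred P]
    (hpos : ∀ T ⊆ Finset.range n, P T → 0 < prefixCount T n)
    (hP : ∀ T ⊆ Finset.range n, ∀ hT : 0 < prefixCount T n,
      P T ↔ (prefixGame n T hT).IsWeighted ∧ Q (prefixGame n T hT)) :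
    (Quotient.mk (isoSetoid (Fin n)) ''
      {G | G.IsWeighted ∧ Q G ∧ G.numShiftMinimal = 1}).ncard =
      ((Finset.range n).powerset.filter P).card := by
  rw [← Set.ncard_coe_finset]
  symm
  have hmem : ∀ T, T ∈ (((Finset.range n).powerset.filter P : Finset _) : Set (Finset ℕ)) →
      T ⊆ Finset.range n ∧ P T := by
    intro T hT
    simpa using hT
  refine Set.ncard_congr (fun T hT => Quotient.mk _
    (prefixGame n T (hpos T (hmem T hT).1 (hmem T hT).2))) ?_ ?_ ?_
  · intro T hT
    obtain ⟨h1, h2⟩ := (hP T (hmem T hT).1 (hpos T (hmem T hT).1 (hmem T hT).2)).1 (hmem T hT).2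
    exact ⟨_, ⟨h1, h2, prefixGame.numShiftMinimal_eq_one (hmem T hT).1⟩, rfl⟩
  · intro T T' hT hT' h
    exact prefixGame.eq_of_isomorphic (hmem T hT).1 (hmem T' hT').1 (Quotient.exact h)
  · rintro _ ⟨G, ⟨hw, hQG, h1⟩, rfl⟩
    obtain ⟨T, hTn, hT, hiso⟩ := hw.exists_isomorphic_prefixGame h1
    have hPT : P T := (hP T hTn hT).2 ⟨hiso.symm.isWeighted hw, hQ _ _ hiso.symm hQG⟩
    exact ⟨T, by simpa using ⟨hTn, hPT⟩, Quotient.sound hiso⟩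

namespace Phase

/-- The phases that belong to weighted games with `t` classes, for words that begin with a one
or not, according to `v`. -/
def Accepts (t : ℕ) (v : Bool) (p : Phase) : Prop :=
  p ≠ bad ∧ ¬ (p = zero ∧ v = false) ∧ numDescents v p + 1 = t

instance (t : ℕ) (v : Bool) (p : Phase) : Decidable (Accepts t v p) :=
  inferInstanceAs (Decidable (_ ∧ _ ∧ _))

theorem accepts_run_iff {n t : ℕ} {T : Finset ℕ} (hT : 0 < prefixCount T n)
    (hTn : T ⊆ Finset.range n) : Accepts t (decide (0 ∈ T)) (run T n) ↔
      (prefixGame n T hT).IsWeighted ∧ (prefixGame n T hT).numClasses = t := by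
  rw [prefixGame.isWeighted_iff hTn, prefixGame.numClasses_eq hTn]
  obtain ⟨m, rfl⟩ : ∃ m, n = m + 1 :=
    ⟨n - 1, by have := prefixCount.le_self (T := T) (k := n); omega⟩
  have h0 := (run_eq_zero_iff T m).not.1 hT.ne'
  unfold Accepts
  refine and_congr_right fun h => ?_
  rw [← (lastLetter_and_descents T m h).2]
  simp only [decide_eq_false_iff_not, h0, not_false_eq_true, true_and, Nat.add_sub_cancel]

theorem prefixCount_pos_of_accepts {n t : ℕ} {T : Finset ℕ} (hn : 1 ≤ n)
    (h : Accepts t (decide (0 ∈ T)) (run T n)) : 0 < prefixCount T n := by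
  obtain ⟨m, rfl⟩ : ∃ m, n = m + 1 := ⟨n - 1, by omega⟩
  rw [Nat.pos_iff_ne_zero, Ne, run_eq_zero_iff]
  simpa using h.2.1

end Phase

theorem card_filter_eq_phaseSum (n : ℕ) (f : Bool → Phase → Prop) [∀ v p, Decidable (f v p)] :
    (((Finset.range n).powerset.filter fun T => f (decide (0 ∈ T)) (Phase.run T n)).card : ℚ) =
      phaseSum n false (fun p => if f false p then 1 else 0) +
        phaseSum n true (fun p => if f true p then 1 else 0) := by
  unfold phaseSum
  rw [Finset.card_filter, Nat.cast_sum, Finset.sum_filter, Finset.sum_filter,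
    ← Finset.sum_add_distrib]
  refine Finset.sum_congr rfl fun T _ => ?_
  by_cases h : 0 ∈ T <;> simp [h]

theorem wg_one_eq_phaseSum {n : ℕ} (hn : 1 ≤ n) (t : ℕ) : (wg n t 1 : ℚ) =
    phaseSum n false (fun p => if p.Accepts t false then 1 else 0) +
      phaseSum n true (fun p => if p.Accepts t true then 1 else 0) := by
  rw [← card_filter_eq_phaseSum n fun v p => p.Accepts t v]
  exact congrArg _ (ncard_image_mk_eq (Q := fun G => G.numClasses = t)
    (fun G G' h hG => h.numClasses_eq.symm.trans hG)
    (fun T _ h => Phase.prefixCount_pos_of_accepts hn h)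
    fun T hTn hT => Phase.accepts_run_iff hT hTn)

theorem wgNontrivial_one_eq_phaseSum {n : ℕ} (hn : 1 ≤ n) (t : ℕ) : (wgNontrivial n t 1 : ℚ) =
    phaseSum n false (fun p => if p.Accepts t false ∧ p.lastLetter = true then 1 else 0) := by
  have h := ncard_image_mk_eq (n := n) (Q := fun G => G.IsNontrivial ∧ G.numClasses = t)
    (P := fun T => Phase.Accepts t (decide (0 ∈ T)) (Phase.run T n) ∧
      decide (0 ∈ T) = false ∧ (Phase.run T n).lastLetter = true)
    (fun G G' h hG => ⟨h.isNontrivial hG.1, h.numClasses_eq.symm.trans hG.2⟩)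
    (fun T _ h => Phase.prefixCount_pos_of_accepts hn h.1) ?_
  · have hset : wgNontrivial n t 1 = _ :=
      (congrArg (fun s => (Quotient.mk (isoSetoid (Fin n)) '' s).ncard)
        (Set.ext fun G => by simp only [Set.mem_ofPred_eq, and_assoc])).trans h
    rw [hset, card_filter_eq_phaseSum n
      fun v p => p.Accepts t v ∧ v = false ∧ p.lastLetter = true]
    simp [phaseSum]
  · intro T hTn hT
    rw [prefixGame.isNontrivial_iff hTn, and_left_comm (b := _ ∧ _),
      ← Phase.accepts_run_iff hT hTn, and_comm (b := Phase.Accepts _ _ _)]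
    refine and_congr_right fun h => ?_
    obtain ⟨m, rfl⟩ : ∃ m, n = m + 1 := ⟨n - 1, by omega⟩
    rw [← (Phase.lastLetter_and_descents T m h.1).1]
    simp

theorem theoremt (n : ℕ) (hn : 1 ≤ n) :
    (wgNontrivial n 1 1 : ℚ) = n - 1 ∧
    (wgNontrivial n 2 1 : ℚ) = (if n ≤ 2 then 0 else (n : ℚ) ^ 2 - 6 * n + 9) ∧
    (∀ t : ℕ, 3 ≤ t → wgNontrivial n t 1 = 0) ∧
    wg n 1 1 = n ∧
    (wg n 2 1 : ℚ) = (if n ≤ 2 then (n : ℚ) - 1 else 2 * ((n : ℚ) - 2) ^ 2 + 2) ∧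
    (wg n 3 1 : ℚ) =
      (if n ≤ 3 then 0 else (5 * (n : ℚ) ^ 3 - 48 * n ^ 2 + 157 * n - 174) / 6) ∧
    (wg n 4 1 : ℚ) =
      (if n ≤ 5 then 0 else
        ((n : ℚ) ^ 4 - 16 * n ^ 3 + 95 * n ^ 2 - 248 * n + 240) / 12) ∧
    (∀ t : ℕ, 5 ≤ t → wg n t 1 = 0) := by
  have hW := fun t => wg_one_eq_phaseSum hn t
  have hN := fun t => wgNontrivial_one_eq_phaseSum hn t
  have hzero : ∀ v, phaseSum n v (fun _ => 0) = 0 := fun v => by simp [phaseSum]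
  -- Three blocks of ones, the first of them leading, give at most three descents.
  have hlarge : ∀ t, 5 ≤ t → ∀ v p, ¬ Phase.Accepts t v p := by
    rintro t ht v p ⟨-, -, h⟩
    cases p <;> cases v <;> simp [Phase.numDescents] at h <;> omega
  -- A word that begins with 0 and ends with 1 has at most one descent unless it is `bad`.
  have hlargeN : ∀ t, 3 ≤ t → ∀ p : Phase, ¬ (p.Accepts t false ∧ p.lastLetter = true) := by
    rintro t ht p ⟨⟨-, -, h⟩, h'⟩
    cases p <;> simp [Phase.numDescents, Phase.lastLetter] at h h' <;> omega
  have hN3 : ∀ t, 3 ≤ t → wgNontrivial n t 1 = 0 := by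
    intro t ht
    have := hN t
    simp only [hlargeN t ht, if_false, hzero] at this
    exact_mod_cast this
  have hW5 : ∀ t, 5 ≤ t → wg n t 1 = 0 := by
    intro t ht
    have := hW t
    simp only [hlarge t ht, if_false, hzero, add_zero] at this
    exact_mod_cast this
  rw [← Nat.cast_inj (R := ℚ) (m := wg n 1 1), hN, hN, hW, hW, hW, hW]
  rcases (by omega : n = 1 ∨ n = 2 ∨ 3 ≤ n) with rfl | rfl | h3
  · refine ⟨?_, ?_, hN3, ?_, ?_, ?_, ?_, hW5⟩ <;>
      simp [phaseSum.one_false, phaseSum.one_true, Phase.Accepts, Phase.numDescents,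
        Phase.lastLetter]
  · refine ⟨?_, ?_, hN3, ?_, ?_, ?_, ?_, hW5⟩ <;>
      simp [phaseSum.two_false, phaseSum.two_true, Phase.Accepts, Phase.numDescents,
        Phase.lastLetter] <;> norm_num
  · have hF : ∀ t, Phase.Accepts t false .bad = False := fun t => eq_false fun h => h.1 rfl
    have hT : ∀ t, Phase.Accepts t true .bad = False := fun t => eq_false fun h => h.1 rfl
    have hn0 : ¬ n ≤ 2 := by omega
    refine ⟨?_, ?_, hN3, ?_, ?_, ?_, ?_, hW5⟩ <;> rw [phaseSum.eq_false n h3 _ (by simp [hF])]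
    on_goal 3 => rw [phaseSum.eq_true n h3 _ (by simp [hT])]
    on_goal 4 => rw [phaseSum.eq_true n h3 _ (by simp [hT])]
    on_goal 5 => rw [phaseSum.eq_true n h3 _ (by simp [hT])]
    on_goal 6 => rw [phaseSum.eq_true n h3 _ (by simp [hT])]
    all_goals simp [Phase.Accepts, Phase.numDescents, Phase.lastLetter, hn0]
    · ring
    · ring
    -- The polynomial for three classes vanishes at n = 3, and the one for four classes at n = 3, 4,
    -- 5, so the case splits in the statement agree with the general count.
    · split_ifs with h
      · obtain rfl : n = 3 := by omega
        norm_num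
      · ring
    · intro h
      interval_cases n <;> norm_num
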